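/- **Proposition 3.1.** Let $T>0$, $K>0$ and $\mathcal X=\{1,\dots,k\}$. Let $r:\mathcal X\to\mathbb R$ and $\sigma:\mathcal X\to(0,\infty)$. Let $(p_{ij})$ be an irreducible stochastic matrix on $\mathcal X$ with $p_{ii}=0$ for all $i$. For each $i\in\mathcal X$ let $F(\cdot\mid i)$ be the distribution function of a probability law on $(0,\infty)$ that is differentiable on $(0,\infty)$, with derivative $f(\cdot\mid i)$ bounded, continuously differentiable and nowhere zero on $(0,\infty)$. Put $$\mathcal D=\{(t,s,i,y): 0<t<T,\ s>0,\ i\in\mathcal X,\ 0<y<t\},\qquad \overline{\mathcal D}=\{(t,s,i,y): 0\le t\le T,\ s\ge 0,\ i\in\mathcal X,\ 0\le y\le t\}.$$ For $s,v,x>0$ let $$\alpha(x;s,i,v)=\frac{1}{\sqrt{2\pi}\,x\,\sigma(i)\sqrt v}\exp\left(-\frac12\left(\frac{\ln(x/s)-(r(i)-\frac{\sigma^2(i)}2)v}{\sigma(i)\sqrt v}\right)^2\right),$$ and let $\eta_i(t,s)$ be the Black–Scholes price at time $t$ and stock price $s$ of the European call with strike $K$ and maturity $T$, for the constant interest rate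 $r(i)$ and volatility $\sigma(i)$; that is, with $Z$ standard normal, $$\eta_i(t,s)=e^{-r(i)(T-t)}\,E\left[\left(s\,e^{(r(i)-\frac{\sigma^2(i)}2)(T-t)+\sigma(i)\sqrt{T-t}\,Z}-K\right)^+\right].$$ Consider the Volterra integral equation $$\varphi(t,s,i,y)=\frac{1-F(T-t+y\mid i)}{1-F(y\mid i)}\,\eta_i(t,s)+\int_0^{T-t}e^{-r(i)v}\frac{f(y+v\mid i)}{1-F(y\mid i)}\sum_j p_{ij}\int_0^\infty\varphi(t+v,x,j,0)\,\alpha(x;s,i,v)\,dx\,dv$$ for $(t,s,i,y)\in\overline{\mathcal D}$ with $s>0$, together with $\varphi(t,0,i,y)=0$ for all $t\in[0,T]$, $i\in\mathcal X$, $y\in[0,t]$. In the class of continuous functions $\varphi$ on $\overline{\mathcal D}$ of at most linear growth in $s$ (that is, $|\varphi(t,s,i,y)|\le C(1+s)$ on $\overline{\mathcal D}$ for some constant $C$), this problem has exactly one solution. This solution $\varphi$ is a classical solution of the following initial-boundary value problem, i.e. it is continuous on $\overline{\mathcal D}$, the derivatives $\partial_t\varphi$, $\partial_s\varphi$, $\partial_s^2\varphi$,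 $\partial_y\varphi$ exist and are continuous on $\mathcal D$, and $$\frac{\partial\varphi}{\partial t}(t,s,i,y)+\frac{\partial\varphi}{\partial y}(t,s,i,y)+r(i)s\frac{\partial\varphi}{\partial s}(t,s,i,y)+\frac12\sigma^2(i)s^2\frac{\partial^2\varphi}{\partial s^2}(t,s,i,y)+\frac{f(y\mid i)}{1-F(y\mid i)}\sum_{j\ne i}p_{ij}\left[\varphi(t,s,j,0)-\varphi(t,s,i,y)\right]=r(i)\,\varphi(t,s,i,y)$$ for all $(t,s,i,y)\in\mathcal D$, with $$\varphi(t,0,i,y)=0\quad(0\le t\le T,\ i\in\mathcal X,\ 0\le y\le t),\qquad \varphi(T,s,i,y)=(s-K)^+\quad(s\ge0,\ 0\le y\le T,\ i\in\mathcal X).$$ -/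

import Mathlib

open MeasureTheory ProbabilityTheory Set
open scoped BigOperators

/-- The parameters of a semi-Markov modulated Black--Scholes market with regimes `Fin k`:
interest rates, volatilities, transition probabilities of the embedded chain, and the conditional
laws of the holding times. The functions `F(· ∣ i)` and `f(· ∣ i)` are the distribution function
and the density of `holdingLaw i`. -/
structure SemiMarkovMarket (k : ℕ) where
  /-- interest rate in each regime -/
  r : Fin k → ℝ
  /-- volatility in each regime -/
  σ : Fin k → ℝ
  σ_pos : ∀ i, 0 < σ i
  /-- transition probabilities at the jump times -/
  p : Matrix (Fin k) (Fin k) ℝ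
  p_nonneg : ∀ i j, 0 ≤ p i j
  p_sum : ∀ i, ∑ j, p i j = 1
  /-- every transition is an actual change of regime -/
  p_diag : ∀ i, p i i = 0
  p_irreducible : p.IsIrreducible
  /-- conditional law of the holding time in each regime -/
  holdingLaw : Fin k → Measure ℝ
  holdingLaw_prob : ∀ i, IsProbabilityMeasure (holdingLaw i)
  /-- holding times are strictly positive -/
  holdingLaw_Iic_zero : ∀ i, holdingLaw i (Iic 0) = 0
  /-- holding time density `f(y ∣ i)`; only its values at `y > 0` matter -/
  f : Fin k → ℝ → ℝ
  hasDerivAt_cdf : ∀ i, ∀ y, 0 < y → HasDerivAt (fun u => cdf (holdingLaw i) u) (f i y) y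
  f_bounded : ∀ i, ∃ C, ∀ y, 0 < y → |f i y| ≤ C
  f_contDiff : ∀ i, ContDiffOn ℝ 1 (f i) (Ioi 0)
  f_ne_zero : ∀ i, ∀ y, 0 < y → f i y ≠ 0

namespace SemiMarkovMarket

variable {k : ℕ}

/-- The conditional holding time distribution function `F(y ∣ i)`. -/
noncomputable def F (M : SemiMarkovMarket k) (i : Fin k) (y : ℝ) : ℝ :=
  cdf (M.holdingLaw i) y

end SemiMarkovMarket

/-- The Black--Scholes price at time `t` and stock price `s` of the European call with maturity `T`
and strike `K`, for constant interest rate `r` and volatility `σ`: the discounted risk-neutral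
expectation `e^{-r(T-t)} E[(S_T - K)^+ ∣ S_t = s]`, where
`S_T = s exp((r - σ²/2)(T-t) + σ √(T-t) Z)` with `Z` standard normal. -/
noncomputable def blackScholesCall (T K r σ t s : ℝ) : ℝ :=
  Real.exp (-r * (T - t)) *
    ∫ z, max (s * Real.exp ((r - σ ^ 2 / 2) * (T - t) + σ * Real.sqrt (T - t) * z) - K) 0
      ∂(gaussianReal 0 1)

/-- The lognormal density `x ↦ α(x; s, v)` of the risk-neutral stock price after a time `v`,
started from `s`, for constant interest rate `r` and volatility `σ`. -/
noncomputable def lognormalKernel (r σ s v x : ℝ) : ℝ :=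
  Real.exp (-(1 / 2) * ((Real.log (x / s) - (r - σ ^ 2 / 2) * v) / (σ * Real.sqrt v)) ^ 2) /
    (Real.sqrt (2 * Real.pi) * x * σ * Real.sqrt v)

/-- The open domain `0 < t < T`, `s > 0`, `0 < y < t`, as a set of triples `(t, s, y)`; the
domain of the problem is one copy of it for each regime. -/
def openDomain (T : ℝ) : Set (ℝ × ℝ × ℝ) :=
  {q | 0 < q.1 ∧ q.1 < T ∧ 0 < q.2.1 ∧ 0 < q.2.2 ∧ q.2.2 < q.1}

/-- The closure of the domain: `0 ≤ t ≤ T`, `s ≥ 0`, `0 ≤ y ≤ t`. -/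
def closedDomain (T : ℝ) : Set (ℝ × ℝ × ℝ) :=
  {q | 0 ≤ q.1 ∧ q.1 ≤ T ∧ 0 ≤ q.2.1 ∧ 0 ≤ q.2.2 ∧ q.2.2 ≤ q.1}

/-- Continuity of `φ(t, s, i, y)` on the closure of the domain. -/
def IsContinuousOnClosedDomain {k : ℕ} (T : ℝ) (φ : ℝ → ℝ → Fin k → ℝ → ℝ) : Prop :=
  ∀ i, ContinuousOn (fun q : ℝ × ℝ × ℝ => φ q.1 q.2.1 i q.2.2) (closedDomain T)

/-- At most linear growth in `s`, uniformly in the other variables. -/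
def HasLinearGrowth {k : ℕ} (T : ℝ) (φ : ℝ → ℝ → Fin k → ℝ → ℝ) : Prop :=
  ∃ C : ℝ, ∀ t s i y, (t, s, y) ∈ closedDomain T → |φ t s i y| ≤ C * (1 + s)

/-- `φ` solves the Volterra integral equation, together with the condition `φ = 0` at `s = 0`. -/
structure SolvesIntegralEquation {k : ℕ} (M : SemiMarkovMarket k) (T K : ℝ)
    (φ : ℝ → ℝ → Fin k → ℝ → ℝ) : Prop where
  equation : ∀ t s i y, (t, s, y) ∈ closedDomain T → 0 < s →
    φ t s i y =
      (1 - M.F i (T - t + y)) / (1 - M.F i y) * blackScholesCall T K (M.r i) (M.σ i) t s +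
      ∫ v in (0 : ℝ)..(T - t),
        Real.exp (-M.r i * v) * (M.f i (y + v) / (1 - M.F i y)) *
          ∑ j, M.p i j *
            ∫ x in Ioi (0 : ℝ), φ (t + v) x j 0 * lognormalKernel (M.r i) (M.σ i) s v x
  zero_at_zero : ∀ t i y, (t, 0, y) ∈ closedDomain T → φ t 0 i y = 0

/-- `φ` is of class `C^{1,2,1}` on the open domain: once continuously differentiable in `t`,
twice in `s` and once in `y`, with all these partial derivatives jointly continuous. -/
structure IsC121 {k : ℕ} (T : ℝ) (φ : ℝ → ℝ → Fin k → ℝ → ℝ) : Prop where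
  differentiable_t : ∀ t s i y, (t, s, y) ∈ openDomain T →
    DifferentiableAt ℝ (fun t' => φ t' s i y) t
  differentiable_s : ∀ t s i y, (t, s, y) ∈ openDomain T →
    DifferentiableAt ℝ (fun s' => φ t s' i y) s
  differentiable_ss : ∀ t s i y, (t, s, y) ∈ openDomain T →
    DifferentiableAt ℝ (deriv (fun s' => φ t s' i y)) s
  differentiable_y : ∀ t s i y, (t, s, y) ∈ openDomain T →
    DifferentiableAt ℝ (fun y' => φ t s i y') y
  continuous : ∀ i, ContinuousOn (fun q : ℝ × ℝ × ℝ => φ q.1 q.2.1 i q.2.2) (openDomain T)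
  continuous_t : ∀ i, ContinuousOn
    (fun q : ℝ × ℝ × ℝ => deriv (fun t' => φ t' q.2.1 i q.2.2) q.1) (openDomain T)
  continuous_s : ∀ i, ContinuousOn
    (fun q : ℝ × ℝ × ℝ => deriv (fun s' => φ q.1 s' i q.2.2) q.2.1) (openDomain T)
  continuous_ss : ∀ i, ContinuousOn
    (fun q : ℝ × ℝ × ℝ => deriv (deriv (fun s' => φ q.1 s' i q.2.2)) q.2.1) (openDomain T)
  continuous_y : ∀ i, ContinuousOn
    (fun q : ℝ × ℝ × ℝ => deriv (fun y' => φ q.1 q.2.1 i y') q.2.2) (openDomain T)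

/-- `φ` is a classical solution of the initial-boundary value problem for the call option price:
it is `C^{1,2,1}` on the open domain and continuous on its closure, satisfies the non-local
partial differential equation on the open domain, vanishes at `s = 0`, and equals the payoff at
time `T`. -/
structure IsClassicalSolution {k : ℕ} (M : SemiMarkovMarket k) (T K : ℝ)
    (φ : ℝ → ℝ → Fin k → ℝ → ℝ) : Prop where
  regular : IsC121 T φ
  continuous : IsContinuousOnClosedDomain T φ
  pde : ∀ t s i y, (t, s, y) ∈ openDomain T →
    deriv (fun t' => φ t' s i y) t + deriv (fun y' => φ t s i y') y
      + M.r i * s * deriv (fun s' => φ t s' i y) s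
      + 1 / 2 * M.σ i ^ 2 * s ^ 2 * deriv (deriv (fun s' => φ t s' i y)) s
      + M.f i y / (1 - M.F i y) *
          ∑ j ∈ Finset.univ.erase i, M.p i j * (φ t s j 0 - φ t s i y)
      = M.r i * φ t s i y
  boundary : ∀ t i y, (t, 0, y) ∈ closedDomain T → φ t 0 i y = 0
  terminal : ∀ s i y, 0 ≤ s → 0 ≤ y → y ≤ T → φ T s i y = max (s - K) 0

/-! The integral in the equation sees the unknown only at age zero, so everything reduces to the
traces `G j t s = φ t s j 0`, which satisfy a closed Volterra equation. Once `G` is known, the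
right-hand side `volterra M T K G` defines the solution at every age. Uniqueness follows the same
way: the trace of any other solution solves the same closed equation, and the trace determines the
solution.

The closed equation is solved by contraction. In the norm weighted by `(1 + s) * exp (2 * B * (T -
t))`, with `B` bounding both `|f|` and `|f| * exp (-r v)`, the discounted expectation preserves
linear growth, and the factor `exp (-2 * B * v)` gained over a delay `v` integrates to at most `1 /
(2 * B)`. The operator therefore halves distances (`abs_duhamel_le`).

Regularity is the delicate point. Smoothing a general payoff of linear growth over a time `v` costs
`1 / v` in the second derivative, which is not integrable at `v = 0`. The remedy is that `G` is
1-Lipschitz in `s`. The call payoff is 1-Lipschitz, discounted stock prices are martingales, and the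
weights `1 - F (T - t)` and `f` have total mass one. Hence the operator preserves this property
(`abs_volterra_sub_volterra_le`), and so does the limit of its iterates. For Lipschitz payoffs the
second derivative costs only `1 / √v` (`exists_deriv_discountedMean`), which allows differentiation
under the integral twice in `s`.

No differentiability of `G` in time is available. In the time derivative the variable `u = t + v` is
therefore used, with the delay `u - t` as the only place where `t` enters the integrand. Fubini on a
triangle then turns the integral into one with moving lower end point (`hasDerivAt_duhamel`).
Differentiating the formula for `φ` along `∂t + ∂y` makes the terms in `f'` and in `f (T - t + y)`
cancel. What remains is the Black–Scholes operator, the source `f y * ∑ p i j * G j` from the lower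
end point, and the killing term from the denominator `1 - F y`, which is the equation
(`exists_deriv_volterra`). -/

/-! ### Expectations along geometric Brownian motion. -/

/-- The expectation of `g (S_v)` for a geometric Brownian motion `S` with drift `r` and volatility
`σ`, started from `s`. -/
noncomputable def gbmMean (r σ : ℝ) (g : ℝ → ℝ) (v s : ℝ) : ℝ :=
  ∫ z, g (s * Real.exp ((r - σ ^ 2 / 2) * v + σ * Real.sqrt v * z)) ∂(gaussianReal 0 1)

/-- The centred Gaussian density of variance `τ`. -/
noncomputable def heatKernel (τ w : ℝ) : ℝ :=
  (Real.sqrt (2 * Real.pi * τ))⁻¹ * Real.exp (-w ^ 2 / (2 * τ))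

lemma integrable_exp_mul_abs_gaussian (c : ℝ) :
    Integrable (fun z : ℝ => Real.exp (c * |z|)) (gaussianReal 0 1) := by
  have h := (integrable_exp_mul_gaussianReal (μ := 0) (v := 1) c).add
    (integrable_exp_mul_gaussianReal (μ := 0) (v := 1) (-c))
  refine h.mono' (by fun_prop) (Filter.Eventually.of_forall fun z => ?_)
  rw [Real.norm_of_nonneg (Real.exp_pos _).le]
  rcases abs_cases z with ⟨hz, _⟩ | ⟨hz, _⟩ <;> simp only [hz, Pi.add_apply]
  · linarith [Real.exp_pos (-c * z)]
  · rw [show c * -z = -c * z by ring]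
    linarith [Real.exp_pos (c * z)]

lemma pow_abs_le_factorial_mul_exp (n : ℕ) (z : ℝ) :
    |z| ^ n ≤ n.factorial * Real.exp |z| := by
  have := Real.pow_div_factorial_le_exp |z| (abs_nonneg z) n
  rw [div_le_iff₀ (by positivity)] at this
  linarith

lemma integrable_pow_abs_mul_exp_gaussian (n : ℕ) (c : ℝ) :
    Integrable (fun z : ℝ => |z| ^ n * Real.exp (c * |z|)) (gaussianReal 0 1) := by
  refine ((integrable_exp_mul_abs_gaussian (c + 1)).const_mul (n.factorial : ℝ)).mono'
    (by fun_prop) (Filter.Eventually.of_forall fun z => ?_)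
  rw [Real.norm_of_nonneg (by positivity), show (c + 1) * |z| = |z| + c * |z| by ring,
    Real.exp_add, ← mul_assoc]
  exact mul_le_mul_of_nonneg_right (pow_abs_le_factorial_mul_exp n z) (Real.exp_pos _).le

/-- The Gaussian moment generating function contributes `σ ^ 2 * v / 2`, exactly the Itô correction
in the drift. This is the martingale property behind all later growth and Lipschitz bounds. -/
lemma integral_exp_gbm (r σ v : ℝ) (hv : 0 ≤ v) :
    ∫ z, Real.exp ((r - σ ^ 2 / 2) * v + σ * Real.sqrt v * z) ∂(gaussianReal 0 1)
      = Real.exp (r * v) := by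
  have h := mgf_gaussianReal (p := gaussianReal 0 1) (X := id) (μ := 0) (v := 1)
    (by simp) (σ * Real.sqrt v)
  simp only [mgf, id] at h
  simp only [Real.exp_add]
  rw [integral_const_mul, h, ← Real.exp_add]
  congr 1
  rw [mul_pow, Real.sq_sqrt hv]
  push_cast
  ring

lemma integrable_exp_gbm (r σ v : ℝ) :
    Integrable (fun z => Real.exp ((r - σ ^ 2 / 2) * v + σ * Real.sqrt v * z))
      (gaussianReal 0 1) := by
  simp only [Real.exp_add]
  exact (integrable_exp_mul_gaussianReal _).const_mul _

lemma integrable_gbm {g : ℝ → ℝ} (hg : Continuous g) {C : ℝ} (hC : ∀ x, |g x| ≤ C * (1 + |x|))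
    (r σ v s : ℝ) :
    Integrable (fun z => g (s * Real.exp ((r - σ ^ 2 / 2) * v + σ * Real.sqrt v * z)))
      (gaussianReal 0 1) := by
  refine (((integrable_const (1 : ℝ)).add ((integrable_exp_gbm r σ v).const_mul |s|)).const_mul
    C).mono' (by fun_prop) (Filter.Eventually.of_forall fun z => ?_)
  refine (hC _).trans_eq ?_
  rw [abs_mul, abs_of_pos (Real.exp_pos _)]
  rfl

/-- An affine bound on the payoff on the half-line bounds the expectation, `S` being a martingale
up to the factor `exp (r v)`. -/
lemma abs_gbmMean_le {g : ℝ → ℝ} {A B r σ v s : ℝ} (hs : 0 ≤ s)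
    (hC : ∀ x, 0 ≤ x → |g x| ≤ A + B * x) (hv : 0 ≤ v) :
    |gbmMean r σ g v s| ≤ A + B * (s * Real.exp (r * v)) := by
  have hi := (integrable_const (μ := gaussianReal 0 1) A).add
    (((integrable_exp_gbm r σ v).const_mul s).const_mul B)
  refine (norm_integral_le_of_norm_le hi (f := fun z => g (s * Real.exp ((r - σ ^ 2 / 2) * v +
    σ * Real.sqrt v * z))) (Filter.Eventually.of_forall fun z => ?_)).trans_eq ?_
  · exact hC _ (mul_nonneg hs (Real.exp_pos _).le)
  · simp only [Pi.add_apply]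
    rw [integral_add (integrable_const _) (((integrable_exp_gbm r σ v).const_mul s).const_mul B),
      integral_const_mul, integral_const_mul, integral_exp_gbm r σ v hv]
    simp

lemma gbmMean_sub {g g' : ℝ → ℝ} (hg : Continuous g) (hg' : Continuous g') {C C' : ℝ}
    (hC : ∀ x, |g x| ≤ C * (1 + |x|)) (hC' : ∀ x, |g' x| ≤ C' * (1 + |x|)) (r σ v s : ℝ) :
    gbmMean r σ (fun x => g x - g' x) v s = gbmMean r σ g v s - gbmMean r σ g' v s :=
  integral_sub (integrable_gbm hg hC r σ v s) (integrable_gbm hg' hC' r σ v s)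

lemma gbmMean_sum {ι : Type*} (t : Finset ι) {g : ι → ℝ → ℝ} (hg : ∀ j, Continuous (g j)) {C : ℝ}
    (hC : ∀ j x, |g j x| ≤ C * (1 + |x|)) (p : ι → ℝ) (r σ v s : ℝ) :
    gbmMean r σ (fun x => ∑ j ∈ t, p j * g j x) v s = ∑ j ∈ t, p j * gbmMean r σ (g j) v s := by
  simp only [gbmMean]
  rw [integral_finsetSum _ fun j _ => (integrable_gbm (hg j) (hC j) r σ v s).const_mul (p j)]
  simp only [integral_const_mul]

lemma gbmMean_zero_right {g : ℝ → ℝ} (h : g 0 = 0) (r σ v : ℝ) : gbmMean r σ g v 0 = 0 := by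
  simp [gbmMean, h]

lemma gbmMean_zero_left {g : ℝ → ℝ} (r σ s : ℝ) : gbmMean r σ g 0 s = g s := by
  simp [gbmMean]

/-- Synchronous coupling: both starting points are driven by the same normal variable, so the two
prices differ by `|s - s'|` times one common exponential. -/
lemma abs_gbmMean_sub_le {g : ℝ → ℝ} (hg : Continuous g) {C : ℝ}
    (hC : ∀ x, |g x| ≤ C * (1 + |x|)) (hL : ∀ x y, 0 ≤ x → 0 ≤ y → |g x - g y| ≤ |x - y|)
    {r σ v s s' : ℝ} (hs : 0 ≤ s) (hs' : 0 ≤ s') (hv : 0 ≤ v) :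
    |gbmMean r σ g v s - gbmMean r σ g v s'| ≤ |s - s'| * Real.exp (r * v) := by
  unfold gbmMean
  rw [← integral_sub (integrable_gbm hg hC r σ v s) (integrable_gbm hg hC r σ v s'),
    ← integral_exp_gbm r σ v hv, ← integral_const_mul]
  rw [← Real.norm_eq_abs]
  refine norm_integral_le_of_norm_le ((integrable_exp_gbm r σ v).const_mul _)
    (Filter.Eventually.of_forall fun z => ?_)
  refine (hL _ _ (mul_nonneg hs (Real.exp_pos _).le)
    (mul_nonneg hs' (Real.exp_pos _).le)).trans_eq ?_
  rw [← sub_mul, abs_mul, abs_of_pos (Real.exp_pos _)]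

/-- Joint continuity of the expectation in the parameter, the time and the starting point. -/
lemma continuous_gbmMean {G : ℝ → ℝ → ℝ} (hG : Continuous fun q : ℝ × ℝ => G q.1 q.2) {C : ℝ}
    (hC : ∀ u x, |G u x| ≤ C * (1 + |x|)) (r σ : ℝ) :
    Continuous fun q : ℝ × ℝ × ℝ => gbmMean r σ (G q.1) q.2.1 q.2.2 := by
  have hC0 : 0 ≤ C := by simpa using (abs_nonneg _).trans (hC 0 0)
  rw [continuous_iff_continuousAt]
  rintro ⟨u₀, v₀, s₀⟩
  set V := |v₀| + 1
  set S := |s₀| + 1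
  refine continuousAt_of_dominated
    (bound := fun z => C * (1 + S * (Real.exp (|r - σ ^ 2 / 2| * V) *
      Real.exp (|σ| * Real.sqrt V * |z|)))) ?_ ?_ ?_ ?_
  · refine Filter.Eventually.of_forall fun q => Continuous.aestronglyMeasurable ?_
    exact hG.comp (by fun_prop : Continuous fun z : ℝ => (q.1, q.2.2 * Real.exp ((r - σ ^ 2 / 2) *
      q.2.1 + σ * Real.sqrt q.2.1 * z)))
  · have h1 : ∀ᶠ q : ℝ × ℝ × ℝ in nhds (u₀, v₀, s₀), |q.2.1| < V :=
      (by fun_prop : Continuous fun q : ℝ × ℝ × ℝ => |q.2.1|).continuousAt.eventually_lt_const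
        (by simp [V])
    have h2 : ∀ᶠ q : ℝ × ℝ × ℝ in nhds (u₀, v₀, s₀), |q.2.2| < S :=
      (by fun_prop : Continuous fun q : ℝ × ℝ × ℝ => |q.2.2|).continuousAt.eventually_lt_const
        (by simp [S])
    filter_upwards [h1, h2] with q hq1 hq2
    refine Filter.Eventually.of_forall fun z => (hC _ _).trans ?_
    rw [abs_mul, abs_of_pos (Real.exp_pos _), ← Real.exp_add]
    have e1 : (r - σ ^ 2 / 2) * q.2.1 ≤ |r - σ ^ 2 / 2| * V :=
      (le_abs_self _).trans ((abs_mul _ _).trans_le (by gcongr))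
    have e2 : σ * Real.sqrt q.2.1 * z ≤ |σ| * Real.sqrt V * |z| := by
      refine (le_abs_self _).trans ?_
      rw [abs_mul, abs_mul, abs_of_nonneg (Real.sqrt_nonneg _)]
      gcongr
      exact (le_abs_self _).trans hq1.le
    have e3 := Real.exp_le_exp.2 (add_le_add e1 e2)
    gcongr
  · exact ((integrable_const _).add (((integrable_exp_mul_abs_gaussian _).const_mul _).const_mul
      _)).const_mul _
  · refine Filter.Eventually.of_forall fun z => Continuous.continuousAt ?_
    exact hG.comp (by fun_prop : Continuous fun q : ℝ × ℝ × ℝ => (q.1, q.2.2 * Real.exp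
      ((r - σ ^ 2 / 2) * q.2.1 + σ * Real.sqrt q.2.1 * z)))

/-! ### Heat kernel and lognormal density. -/

/-- Standardization of a Gaussian integral. -/
lemma integral_mul_heatKernel (H : ℝ → ℝ) {τ : ℝ} (hτ : 0 < τ) (x : ℝ) :
    ∫ y, H y * heatKernel τ (y - x) = ∫ z, H (x + Real.sqrt τ * z) ∂(gaussianReal 0 1) := by
  rw [integral_gaussianReal_eq_integral_smul (by norm_num)]
  rw [← integral_add_left_eq_self (fun y => H y * heatKernel τ (y - x)) x]
  have hs : 0 < Real.sqrt τ := Real.sqrt_pos.2 hτ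
  have h := Measure.integral_comp_mul_left (fun w => H (x + w) * heatKernel τ (x + w - x))
    (Real.sqrt τ)
  rw [abs_of_pos (inv_pos.2 hs), smul_eq_mul] at h
  rw [← mul_inv_cancel_left₀ hs.ne' (∫ y, H (x + y) * heatKernel τ (x + y - x)), ← h,
    ← integral_const_mul]
  refine integral_congr_ae (Filter.Eventually.of_forall fun z => ?_)
  simp only [heatKernel, gaussianPDFReal, smul_eq_mul, NNReal.coe_one, sub_zero, mul_one]
  rw [add_sub_cancel_left, mul_pow, Real.sq_sqrt hτ.le, Real.sqrt_mul (by positivity),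
    show -(τ * z ^ 2) / (2 * τ) = -z ^ 2 / 2 by field_simp]
  field_simp

/-- In the logarithmic coordinate the price is a Brownian motion with drift. Both `s` and `v` then
sit in the kernel only, so derivatives never fall on the payoff. -/
lemma gbmMean_eq_integral_heatKernel (r : ℝ) {σ : ℝ} (hσ : 0 < σ) (g : ℝ → ℝ) {v s : ℝ}
    (hv : 0 < v) (hs : 0 < s) :
    gbmMean r σ g v s = ∫ y, g (Real.exp y) *
      heatKernel (σ ^ 2 * v) (y - (Real.log s + (r - σ ^ 2 / 2) * v)) := by
  rw [integral_mul_heatKernel (fun y => g (Real.exp y)) (by positivity)]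
  unfold gbmMean
  congr 1
  ext z
  rw [Real.sqrt_mul (by positivity), Real.sqrt_sq hσ.le, add_assoc, Real.exp_add (Real.log s),
    Real.exp_log hs]

/-- The expectation of a function of the stock price, as an integral against the lognormal
density. -/
lemma integral_mul_lognormalKernel (r : ℝ) {σ : ℝ} (hσ : 0 < σ) (g : ℝ → ℝ) {v s : ℝ}
    (hv : 0 < v) (hs : 0 < s) :
    ∫ x in Ioi (0 : ℝ), g x * lognormalKernel r σ s v x = gbmMean r σ g v s := by
  rw [gbmMean_eq_integral_heatKernel r hσ g hv hs]
  have h := integral_image_eq_integral_abs_deriv_smul (s := univ) (f := Real.exp) (f' := Real.exp)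
    MeasurableSet.univ (fun x _ => (Real.hasDerivAt_exp x).hasDerivWithinAt)
    Real.exp_injective.injOn (fun x => g x * lognormalKernel r σ s v x)
  rw [image_univ, Real.range_exp, setIntegral_univ] at h
  rw [h]
  congr 1
  ext y
  have hv' : 0 < Real.sqrt v := Real.sqrt_pos.2 hv
  rw [abs_of_pos (Real.exp_pos y), smul_eq_mul, lognormalKernel, heatKernel,
    Real.log_div (Real.exp_pos y).ne' hs.ne', Real.log_exp,
    show 2 * Real.pi * (σ ^ 2 * v) = (2 * Real.pi) * (σ ^ 2 * v) by ring,
    Real.sqrt_mul (by positivity) (σ ^ 2 * v), Real.sqrt_mul (by positivity) v,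
    Real.sqrt_sq hσ.le, div_pow,
    mul_pow, Real.sq_sqrt hv.le]
  have : -(1 / 2) * ((y - Real.log s - (r - σ ^ 2 / 2) * v) ^ 2 / (σ ^ 2 * v)) =
      -(y - (Real.log s + (r - σ ^ 2 / 2) * v)) ^ 2 / (2 * (σ ^ 2 * v)) := by
    field_simp; ring
  rw [this]
  have := (Real.exp_pos y).ne'
  field_simp

/-! ### Derivatives and decay of the heat kernel. -/

/-- Minus the spatial derivative of the heat kernel. -/
noncomputable def heatKernelOne (τ w : ℝ) : ℝ := w / τ * heatKernel τ w

/-- The second spatial derivative of the heat kernel. -/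
noncomputable def heatKernelTwo (τ w : ℝ) : ℝ := (w ^ 2 / τ ^ 2 - 1 / τ) * heatKernel τ w

lemma heatKernel_nonneg (τ w : ℝ) : 0 ≤ heatKernel τ w := by
  unfold heatKernel; positivity

/-- The heat kernel along a curve; its time derivative is half the second spatial derivative. -/
lemma hasDerivAt_heatKernel {τ w : ℝ → ℝ} {τ' w' p : ℝ} (hτ : HasDerivAt τ τ' p)
    (hw : HasDerivAt w w' p) (hp : 0 < τ p) :
    HasDerivAt (fun p => heatKernel (τ p) (w p))
      (τ' / 2 * heatKernelTwo (τ p) (w p) - w' * heatKernelOne (τ p) (w p)) p := by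
  have h0 : 0 < 2 * Real.pi * τ p := by positivity
  have h := (((hτ.const_mul (2 * Real.pi)).sqrt h0.ne').inv (Real.sqrt_pos.2 h0).ne').mul
    (((hw.pow 2).neg.div (hτ.const_mul 2) (by positivity)).exp)
  refine HasDerivAt.congr_deriv h ?_
  simp only [heatKernelOne, heatKernelTwo, heatKernel, Pi.div_apply, Pi.inv_apply, Pi.neg_apply,
    Pi.pow_apply, Real.sq_sqrt h0.le]
  have := (Real.sqrt_pos.2 h0).ne'
  have := Real.pi_pos.ne'
  field_simp
  push_cast
  ring

lemma hasDerivAt_heatKernel_snd {τ : ℝ} (hτ : 0 < τ) (w : ℝ) :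
    HasDerivAt (heatKernel τ) (-heatKernelOne τ w) w := by
  simpa using hasDerivAt_heatKernel (hasDerivAt_const w τ) (hasDerivAt_id w) hτ

lemma hasDerivAt_heatKernelOne_snd {τ : ℝ} (hτ : 0 < τ) (w : ℝ) :
    HasDerivAt (heatKernelOne τ) (-heatKernelTwo τ w) w := by
  have h := ((hasDerivAt_id w).div_const τ).mul (hasDerivAt_heatKernel_snd hτ w)
  refine HasDerivAt.congr_deriv h ?_
  simp only [heatKernelOne, heatKernelTwo, id]
  field_simp
  ring

lemma continuousOn_heatKernel :
    ContinuousOn (fun q : ℝ × ℝ => heatKernel q.1 q.2) {q | 0 < q.1} := by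
  unfold heatKernel
  refine ContinuousOn.mul (ContinuousOn.inv₀ (by fun_prop) fun q (hq : 0 < q.1) => ?_)
    (Real.continuous_exp.comp_continuousOn (ContinuousOn.div (by fun_prop) (by fun_prop)
      fun q (hq : 0 < q.1) => by positivity))
  have : 0 < 2 * Real.pi * q.1 := by positivity
  exact (Real.sqrt_pos.2 this).ne'

lemma continuousOn_heatKernelOne :
    ContinuousOn (fun q : ℝ × ℝ => heatKernelOne q.1 q.2) {q | 0 < q.1} :=
  ContinuousOn.mul (ContinuousOn.div (by fun_prop) (by fun_prop) fun _ hq => (ne_of_gt hq))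
    continuousOn_heatKernel

lemma continuousOn_heatKernelTwo :
    ContinuousOn (fun q : ℝ × ℝ => heatKernelTwo q.1 q.2) {q | 0 < q.1} :=
  ContinuousOn.mul (ContinuousOn.sub
    (ContinuousOn.div (by fun_prop) (by fun_prop) fun _ hq => pow_ne_zero 2 (ne_of_gt hq))
    (ContinuousOn.div (by fun_prop) (by fun_prop) fun _ hq => (ne_of_gt hq)))
    continuousOn_heatKernel

/-- Exponential decay in space, locally uniformly in time. -/
def HasExpDecay (κ : ℝ → ℝ → ℝ) : Prop :=
  ∀ a b, 0 < a → ∃ C, ∀ τ, a ≤ τ → τ ≤ b → ∀ w, |κ τ w| ≤ C * Real.exp (-2 * |w|)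

/-- One polynomial prefactor dominates those of the kernel and of its first two derivatives, so a
single Gaussian estimate serves all three. -/
lemma HasExpDecay.of_le {κ : ℝ → ℝ → ℝ} (h : ∀ τ, 0 < τ → ∀ w,
    |κ τ w| ≤ (1 + |w| / τ + (|w| ^ 2 / τ ^ 2 + 1 / τ)) * heatKernel τ w) : HasExpDecay κ := by
  intro a b ha
  refine ⟨(1 + 1 / a + (2 / a ^ 2 + 1 / a)) * (Real.sqrt (2 * Real.pi * a))⁻¹ *
    Real.exp (9 * b / 2), fun τ h1 h2 w => (h τ (ha.trans_le h1) w).trans ?_⟩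
  have hτ := ha.trans_le h1
  have hb := hτ.trans_le h2
  have hw : 0 ≤ |w| := abs_nonneg w
  have e1 : 1 ≤ Real.exp |w| := Real.one_le_exp hw
  have e2 : |w| ≤ Real.exp |w| := by linarith [Real.add_one_le_exp |w|]
  have e3 : |w| ^ 2 ≤ 2 * Real.exp |w| := by simpa using pow_abs_le_factorial_mul_exp 2 w
  have p1 : 1 + |w| / τ + (|w| ^ 2 / τ ^ 2 + 1 / τ) ≤
      (1 + 1 / a + (2 / a ^ 2 + 1 / a)) * Real.exp |w| := by
    calc 1 + |w| / τ + (|w| ^ 2 / τ ^ 2 + 1 / τ)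
        ≤ Real.exp |w| + Real.exp |w| / a +
          (2 * Real.exp |w| / a ^ 2 + Real.exp |w| / a) := by gcongr
      _ = _ := by ring
  -- Rate 3 leaves rate 2 after one factor `exp |w|` is spent on the polynomial; `9 * b / 2` comes
  -- from completing the square in `|w| - 3 * b`.
  have p2 : heatKernel τ w ≤ (Real.sqrt (2 * Real.pi * a))⁻¹ *
      (Real.exp (9 * b / 2) * Real.exp (-3 * |w|)) := by
    unfold heatKernel
    rw [← Real.exp_add]
    gcongr
    have : -w ^ 2 / (2 * τ) ≤ -w ^ 2 / (2 * b) := by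
      rw [neg_div, neg_div, neg_le_neg_iff]; gcongr
    refine this.trans ?_
    rw [div_le_iff₀ (by positivity), ← sq_abs]
    nlinarith [sq_nonneg (|w| - 3 * b)]
  calc _ ≤ ((1 + 1 / a + (2 / a ^ 2 + 1 / a)) * Real.exp |w|) *
        ((Real.sqrt (2 * Real.pi * a))⁻¹ * (Real.exp (9 * b / 2) * Real.exp (-3 * |w|))) :=
        mul_le_mul p1 p2 (heatKernel_nonneg _ _) (by positivity)
    _ = _ := by
      rw [show -2 * |w| = |w| + -3 * |w| by ring, Real.exp_add]; ring

lemma hasExpDecay_heatKernel : HasExpDecay heatKernel := by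
  refine .of_le fun τ hτ w => ?_
  rw [abs_of_nonneg (heatKernel_nonneg _ _)]
  refine le_mul_of_one_le_left (heatKernel_nonneg _ _) ?_
  have : 0 ≤ |w| / τ + (|w| ^ 2 / τ ^ 2 + 1 / τ) := by positivity
  linarith

lemma hasExpDecay_heatKernelOne : HasExpDecay heatKernelOne := by
  refine .of_le fun τ hτ w => ?_
  rw [heatKernelOne, abs_mul, abs_of_nonneg (heatKernel_nonneg _ _), abs_div, abs_of_pos hτ]
  refine mul_le_mul_of_nonneg_right ?_ (heatKernel_nonneg _ _)
  have : 0 ≤ 1 + (|w| ^ 2 / τ ^ 2 + 1 / τ) := by positivity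
  linarith

lemma hasExpDecay_heatKernelTwo : HasExpDecay heatKernelTwo := by
  refine .of_le fun τ hτ w => ?_
  rw [heatKernelTwo, abs_mul, abs_of_nonneg (heatKernel_nonneg _ _)]
  refine mul_le_mul_of_nonneg_right ((abs_sub _ _).trans ?_) (heatKernel_nonneg _ _)
  have h1 : 0 ≤ 1 + |w| / τ := by positivity
  rw [abs_of_nonneg (by positivity : 0 ≤ w ^ 2 / τ ^ 2), abs_of_pos (by positivity : 0 < 1 / τ),
    sq_abs]
  linarith

lemma integrable_exp_neg_abs : Integrable fun y : ℝ => Real.exp (-|y|) := by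
  refine (integrable_inv_one_add_sq.const_mul 2).mono' (by fun_prop)
    (Filter.Eventually.of_forall fun y => ?_)
  rw [Real.norm_of_nonneg (Real.exp_pos _).le, Real.exp_neg, ← div_eq_mul_inv,
    inv_le_comm₀ (Real.exp_pos _) (by positivity), inv_div]
  have := Real.quadratic_le_exp_of_nonneg (abs_nonneg y)
  rw [sq_abs] at this
  have := abs_nonneg y
  linarith

/-- Payoffs grow like `exp y` in the logarithmic coordinate. Decay at rate 2 around a centre in
`[-X, X]` beats this with rate 1 to spare, because `y - 2 * |y - x| ≤ 2 * X - |y|`. -/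
lemma abs_mul_le_exp_neg_abs {a c y x X C : ℝ} (ha : |a| ≤ Real.exp y) (hx : |x| ≤ X)
    (hc : |c| ≤ C * Real.exp (-2 * |y - x|)) :
    |a * c| ≤ C * Real.exp (2 * X) * Real.exp (-|y|) := by
  have hC : 0 ≤ C := nonneg_of_mul_nonneg_left ((abs_nonneg c).trans hc) (Real.exp_pos _)
  rw [abs_mul]
  calc |a| * |c| ≤ Real.exp y * (C * Real.exp (-2 * |y - x|)) := by gcongr
    _ = C * Real.exp (y + -2 * |y - x|) := by rw [Real.exp_add]; ring
    _ ≤ C * Real.exp (2 * X + -|y|) := by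
      refine mul_le_mul_of_nonneg_left (Real.exp_le_exp.2 ?_) hC
      have := abs_sub_abs_le_abs_sub y x
      have := le_abs_self y
      linarith
    _ = _ := by rw [Real.exp_add]; ring

/-! ### Convolutions with the heat kernel: smoothness and small-time bounds. -/

/-- Differentiation under the integral sign, for kernels with exponential decay. -/
lemma hasDerivAt_integral_of_expDecay {h : ℝ → ℝ} (hh : Continuous h)
    (hb : ∀ y, |h y| ≤ Real.exp y) {K K' : ℝ → ℝ → ℝ} {x : ℝ → ℝ} {p₀ C X : ℝ} {s : Set ℝ}
    (hs : s ∈ nhds p₀) (hx : ∀ p ∈ s, |x p| ≤ X)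
    (hK : ∀ p ∈ s, ∀ y, |K p y| ≤ C * Real.exp (-2 * |y - x p|))
    (hK' : ∀ p ∈ s, ∀ y, |K' p y| ≤ C * Real.exp (-2 * |y - x p|))
    (hKc : ∀ p ∈ s, Continuous (K p)) (hKc' : ∀ p ∈ s, Continuous (K' p))
    (hd : ∀ p ∈ s, ∀ y, HasDerivAt (fun p => K p y) (K' p y) p) :
    HasDerivAt (fun p => ∫ y, h y * K p y) (∫ y, h y * K' p₀ y) p₀ := by
  have hp₀ := mem_of_mem_nhds hs
  have hi := integrable_exp_neg_abs.const_mul (C * Real.exp (2 * X))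
  refine (hasDerivAt_integral_of_dominated_loc_of_deriv_le (𝕜 := ℝ) (F := fun p y => h y * K p y)
    (F' := fun p y => h y * K' p y) hs ?_ ?_ ?_ ?_ hi ?_).2
  · filter_upwards [hs] with p hp
    exact (hh.mul (hKc p hp)).aestronglyMeasurable
  · exact hi.mono' (hh.mul (hKc p₀ hp₀)).aestronglyMeasurable
      (Filter.Eventually.of_forall fun y =>
        abs_mul_le_exp_neg_abs (hb y) (hx p₀ hp₀) (hK p₀ hp₀ y))
  · exact (hh.mul (hKc' p₀ hp₀)).aestronglyMeasurable
  · exact Filter.Eventually.of_forall fun y p hp =>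
      abs_mul_le_exp_neg_abs (hb y) (hx p hp) (hK' p hp y)
  · exact Filter.Eventually.of_forall fun y p hp => (hd p hp y).const_mul _

/-- Continuity of convolutions with kernels of exponential decay. -/
lemma continuousAt_integral_of_hasExpDecay {h : ℝ → ℝ → ℝ}
    (hh : Continuous fun q : ℝ × ℝ => h q.1 q.2) (hb : ∀ u y, |h u y| ≤ Real.exp y)
    {κ : ℝ → ℝ → ℝ} (hκ : HasExpDecay κ)
    (hc : ContinuousOn (fun q : ℝ × ℝ => κ q.1 q.2) {q | 0 < q.1})
    (u₀ : ℝ) {τ₀ : ℝ} (hτ : 0 < τ₀) (x₀ : ℝ) :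
    ContinuousAt (fun q : ℝ × ℝ × ℝ => ∫ y, h q.1 y * κ q.2.1 (y - q.2.2)) (u₀, τ₀, x₀) := by
  obtain ⟨C, hC⟩ := hκ (τ₀ / 2) (2 * τ₀) (by positivity)
  have h1 : ∀ᶠ q : ℝ × ℝ × ℝ in nhds (u₀, τ₀, x₀), τ₀ / 2 < q.2.1 :=
    (by fun_prop : Continuous fun q : ℝ × ℝ × ℝ => q.2.1).continuousAt.eventually_const_lt
      (half_lt_self hτ)
  have h2 : ∀ᶠ q : ℝ × ℝ × ℝ in nhds (u₀, τ₀, x₀), q.2.1 < 2 * τ₀ :=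
    (by fun_prop : Continuous fun q : ℝ × ℝ × ℝ => q.2.1).continuousAt.eventually_lt_const
      (by simp; linarith)
  have h3 : ∀ᶠ q : ℝ × ℝ × ℝ in nhds (u₀, τ₀, x₀), |q.2.2| < |x₀| + 1 :=
    (by fun_prop : Continuous fun q : ℝ × ℝ × ℝ => |q.2.2|).continuousAt.eventually_lt_const
      (by simp)
  refine continuousAt_of_dominated ?_ ?_
    (integrable_exp_neg_abs.const_mul (C * Real.exp (2 * (|x₀| + 1)))) ?_
  · filter_upwards [h1] with q hq
    refine Continuous.aestronglyMeasurable (Continuous.mul ?_ ?_)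
    · exact hh.comp (by fun_prop : Continuous fun y : ℝ => (q.1, y))
    · exact hc.comp_continuous (by fun_prop : Continuous fun y : ℝ => (q.2.1, y - q.2.2))
        fun y => (by simp; linarith)
  · filter_upwards [h1, h2, h3] with q hq1 hq2 hq3
    exact Filter.Eventually.of_forall fun y =>
      abs_mul_le_exp_neg_abs (hb _ y) hq3.le (hC _ hq1.le hq2.le _)
  · refine Filter.Eventually.of_forall fun y => ContinuousAt.mul ?_ ?_
    · exact (hh.comp (by fun_prop : Continuous fun q : ℝ × ℝ × ℝ => (q.1, y))).continuousAt
    · have := hc.continuousAt (x := (τ₀, y - x₀))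
        ((isOpen_lt continuous_const continuous_fst).mem_nhds hτ)
      exact ContinuousAt.comp (f := fun q : ℝ × ℝ × ℝ => (q.2.1, y - q.2.2))
        (x := (u₀, τ₀, x₀)) this (by fun_prop)

lemma abs_exp_sub_one_le_mul_exp (w : ℝ) : |Real.exp w - 1| ≤ |w| * Real.exp |w| := by
  rcases le_total 0 w with hw | hw
  · rw [abs_of_nonneg hw, abs_of_nonneg (by linarith [Real.one_le_exp hw])]
    have h := Real.add_one_le_exp (-w)
    have h2 : Real.exp w * Real.exp (-w) = 1 := by rw [← Real.exp_add]; simp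
    nlinarith [Real.exp_pos w]
  · rw [abs_of_nonpos (by linarith [Real.exp_le_one_iff.2 hw]), abs_of_nonpos hw]
    have h := Real.add_one_le_exp w
    have h2 := Real.one_le_exp (neg_nonneg.2 hw)
    nlinarith

/-- After standardization the factor `(y - x) / τ` becomes `z / √τ`, so the first derivative costs
one power of `√τ` even without a Lipschitz bound. -/
lemma abs_integral_heatKernelOne_le {h : ℝ → ℝ} (hb : ∀ y, |h y| ≤ Real.exp y)
    {τ b : ℝ} (hτ : 0 < τ) (hτb : τ ≤ b) (x : ℝ) :
    |∫ y, h y * heatKernelOne τ (y - x)| ≤ (Real.exp x / Real.sqrt τ) *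
      ∫ z, |z| ^ 1 * Real.exp (Real.sqrt b * |z|) ∂(gaussianReal 0 1) := by
  have h0 : ∀ y, h y * heatKernelOne τ (y - x) = (h y * ((y - x) / τ)) * heatKernel τ (y - x) :=
    fun y => by rw [heatKernelOne]; ring
  simp only [h0]
  rw [integral_mul_heatKernel (fun y => h y * ((y - x) / τ)) hτ, ← integral_const_mul,
    ← Real.norm_eq_abs]
  refine norm_integral_le_of_norm_le ((integrable_pow_abs_mul_exp_gaussian 1 _).const_mul _)
    (Filter.Eventually.of_forall fun z => ?_)
  have hs := Real.sqrt_pos.2 hτ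
  rw [Real.norm_eq_abs, abs_mul, add_sub_cancel_left, abs_div, abs_mul, abs_of_pos hs,
    abs_of_pos hτ]
  calc |h (x + Real.sqrt τ * z)| * (Real.sqrt τ * |z| / τ)
      ≤ Real.exp (x + Real.sqrt b * |z|) * (Real.sqrt τ * |z| / τ) := by
        gcongr
        refine (hb _).trans (Real.exp_le_exp.2 ?_)
        have : Real.sqrt τ * z ≤ Real.sqrt b * |z| := by
          refine (le_abs_self _).trans ?_
          rw [abs_mul, abs_of_pos hs]
          gcongr
        linarith
    _ = _ := by
      rw [Real.exp_add]
      nth_rewrite 2 [← Real.sq_sqrt hτ.le]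
      field_simp

/-- This is where the Lipschitz bound pays. The standardized factor is `(z ^ 2 - 1) / τ`, of mean
zero, so the constant `h x` may be subtracted from the payoff. The difference is of order `√τ *
|z|`, which improves the singularity from `1 / τ` to `1 / √τ`. -/
lemma abs_integral_heatKernelTwo_le {h : ℝ → ℝ} (hh : Continuous h)
    (hb : ∀ y, |h y| ≤ Real.exp y) (hL : ∀ y x, |h y - h x| ≤ |Real.exp y - Real.exp x|)
    {τ b : ℝ} (hτ : 0 < τ) (hτb : τ ≤ b) (x : ℝ) :
    |∫ y, h y * heatKernelTwo τ (y - x)| ≤ (Real.exp x / Real.sqrt τ) *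
      ∫ z, (|z| ^ 3 * Real.exp (Real.sqrt b * |z|) + |z| ^ 1 * Real.exp (Real.sqrt b * |z|))
        ∂(gaussianReal 0 1) := by
  have hs := Real.sqrt_pos.2 hτ
  have h0 : ∀ y, h y * heatKernelTwo τ (y - x) =
      (h y * ((y - x) ^ 2 / τ ^ 2 - 1 / τ)) * heatKernel τ (y - x) :=
    fun y => by rw [heatKernelTwo]; ring
  simp only [h0]
  rw [integral_mul_heatKernel (fun y => h y * ((y - x) ^ 2 / τ ^ 2 - 1 / τ)) hτ]
  have hz : ∀ z, (x + Real.sqrt τ * z - x) ^ 2 / τ ^ 2 - 1 / τ = (z ^ 2 - 1) / τ := fun z => by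
    rw [add_sub_cancel_left, mul_pow, Real.sq_sqrt hτ.le]
    field_simp
  simp only [hz]
  have i2 : Integrable (fun z : ℝ => z ^ 2) (gaussianReal 0 1) := by
    simpa using integrable_pow_abs_mul_exp_gaussian 2 0
  have m2 : ∫ z, z ^ 2 ∂(gaussianReal 0 1) = 1 := by
    have := variance_id_gaussianReal (μ := 0) (v := 1)
    rw [variance_eq_integral (by fun_prop)] at this
    simpa using this
  -- The zero that is subtracted below: unit variance makes `z ^ 2 - 1` centred.
  have m0 : ∫ z, h x * ((z ^ 2 - 1) / τ) ∂(gaussianReal 0 1) = 0 := by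
    rw [integral_const_mul, integral_div, integral_sub i2 (integrable_const _), m2]
    simp
  have hsz : ∀ z, |Real.sqrt τ * z| ≤ Real.sqrt b * |z| := fun z => by
    rw [abs_mul, abs_of_pos hs]; gcongr
  have hI : Integrable (fun z => h (x + Real.sqrt τ * z) * ((z ^ 2 - 1) / τ))
      (gaussianReal 0 1) := by
    refine (((integrable_pow_abs_mul_exp_gaussian 2 (Real.sqrt b)).add
      (integrable_pow_abs_mul_exp_gaussian 0 (Real.sqrt b))).const_mul
        (Real.exp x / τ)).mono' (by fun_prop) (Filter.Eventually.of_forall fun z => ?_)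
    rw [Real.norm_eq_abs, abs_mul, abs_div, abs_of_pos hτ]
    calc |h (x + Real.sqrt τ * z)| * (|z ^ 2 - 1| / τ)
        ≤ (Real.exp x * Real.exp (Real.sqrt b * |z|)) * ((|z| ^ 2 + 1) / τ) := by
          gcongr
          · rw [← Real.exp_add]
            exact (hb _).trans (Real.exp_le_exp.2
              (add_le_add_right ((le_abs_self _).trans (hsz z)) _))
          · exact (abs_sub _ _).trans_eq (by rw [abs_pow, abs_one])
      _ = _ := by simp only [Pi.add_apply]; ring
  have hI' : Integrable (fun z => h x * ((z ^ 2 - 1) / τ)) (gaussianReal 0 1) :=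
    ((i2.sub (integrable_const _)).div_const _).const_mul _
  rw [← sub_zero (∫ z, h (x + Real.sqrt τ * z) * ((z ^ 2 - 1) / τ) ∂(gaussianReal 0 1))]
  nth_rewrite 2 [← m0]
  rw [← integral_sub hI hI', ← integral_const_mul,
    ← Real.norm_eq_abs]
  refine norm_integral_le_of_norm_le (((integrable_pow_abs_mul_exp_gaussian 3 _).add
    (integrable_pow_abs_mul_exp_gaussian 1 _)).const_mul _)
    (Filter.Eventually.of_forall fun z => ?_)
  rw [Real.norm_eq_abs, ← sub_mul, abs_mul, abs_div, abs_of_pos hτ]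
  calc |h (x + Real.sqrt τ * z) - h x| * (|z ^ 2 - 1| / τ)
      ≤ (Real.exp x * (Real.sqrt τ * |z| * Real.exp (Real.sqrt b * |z|))) *
        ((|z| ^ 2 + 1) / τ) := by
        gcongr
        · refine (hL _ _).trans ?_
          rw [Real.exp_add, ← mul_sub_one, abs_mul, abs_of_pos (Real.exp_pos x)]
          gcongr
          refine (abs_exp_sub_one_le_mul_exp _).trans ?_
          have := Real.exp_le_exp.2 (hsz z)
          rw [abs_mul, abs_of_pos hs] at this ⊢
          gcongr
        · exact (abs_sub _ _).trans_eq (by rw [abs_pow, abs_one])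
    _ = _ := by
      rw [show Real.exp x * (Real.sqrt τ * |z| * Real.exp (Real.sqrt b * |z|)) *
        ((|z| ^ 2 + 1) / τ) = Real.exp x * |z| * Real.exp (Real.sqrt b * |z|) * (|z| ^ 2 + 1) *
        (Real.sqrt τ / τ) by ring, Real.sqrt_div_self']
      ring

lemma mul_le_abs_mul (c : ℝ) {v V : ℝ} (hv : 0 ≤ v) (hvV : v ≤ V) : c * v ≤ |c| * V :=
  (mul_le_mul_of_nonneg_right (le_abs_self c) hv).trans
    (mul_le_mul_of_nonneg_left hvV (abs_nonneg c))

/-- The variable is the centre of the kernel, which enters as `y - x`; this undoes the minus sign in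
the hypothesis on `κ'`. -/
lemma hasDerivAt_integral_hasExpDecay {h : ℝ → ℝ} (hh : Continuous h)
    (hb : ∀ y, |h y| ≤ Real.exp y) {κ κ' : ℝ → ℝ → ℝ} (hκ : HasExpDecay κ) (hκ' : HasExpDecay κ')
    (hd : ∀ τ, 0 < τ → ∀ w, HasDerivAt (κ τ) (-κ' τ w) w)
    (hc : ContinuousOn (fun q : ℝ × ℝ => κ' q.1 q.2) {q | 0 < q.1}) {τ : ℝ} (hτ : 0 < τ) (x : ℝ) :
    HasDerivAt (fun x => ∫ y, h y * κ τ (y - x)) (∫ y, h y * κ' τ (y - x)) x := by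
  obtain ⟨C, hC⟩ := hκ τ τ hτ
  obtain ⟨C', hC'⟩ := hκ' τ τ hτ
  have hcont : Continuous (κ τ) :=
    continuous_iff_continuousAt.2 fun w => (hd τ hτ w).continuousAt
  refine hasDerivAt_integral_of_expDecay hh hb (x := id) (X := |x| + 1) (C := max C C')
    (s := Metric.ball x 1) (K := fun x y => κ τ (y - x)) (K' := fun x y => κ' τ (y - x))
    (Metric.ball_mem_nhds x one_pos) (fun p hp => ?_) (fun p _ y => ?_) (fun p _ y => ?_)
    (fun p _ => ?_) (fun p _ => ?_) (fun p _ y => ?_)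
  · rw [Metric.mem_ball, Real.dist_eq] at hp
    have := abs_sub_abs_le_abs_sub p x
    simp only [id]
    linarith
  · exact (hC τ le_rfl le_rfl _).trans
      (mul_le_mul_of_nonneg_right (le_max_left _ _) (Real.exp_pos _).le)
  · exact (hC' τ le_rfl le_rfl _).trans
      (mul_le_mul_of_nonneg_right (le_max_right _ _) (Real.exp_pos _).le)
  · exact hcont.comp (by fun_prop)
  · exact hc.comp_continuous (by fun_prop : Continuous fun y : ℝ => (τ, y - p)) fun _ => hτ
  · have h := (hd τ hτ (y - p)).comp p ((hasDerivAt_id p).const_sub y)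
    exact h.congr_deriv (by ring)

/-- Variance and centre move together with `v`: the heat equation supplies the second-derivative
kernel, the drift `a` the first-derivative one. The time window `(v / 2, 2 * v)` stays away from
zero, so uniform decay applies. -/
lemma hasDerivAt_integral_heatKernel_time {h : ℝ → ℝ} (hh : Continuous h)
    (hb : ∀ y, |h y| ≤ Real.exp y) {σ : ℝ} (hσ : 0 < σ) (a c : ℝ) {v : ℝ} (hv : 0 < v) :
    HasDerivAt (fun v => ∫ y, h y * heatKernel (σ ^ 2 * v) (y - (c + a * v)))
      (∫ y, h y * (σ ^ 2 / 2 * heatKernelTwo (σ ^ 2 * v) (y - (c + a * v)) +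
        a * heatKernelOne (σ ^ 2 * v) (y - (c + a * v)))) v := by
  have hσ2 : 0 < σ ^ 2 := by positivity
  obtain ⟨C0, hC0⟩ := hasExpDecay_heatKernel (σ ^ 2 * (v / 2)) (σ ^ 2 * (2 * v)) (by positivity)
  obtain ⟨C1, hC1⟩ := hasExpDecay_heatKernelOne (σ ^ 2 * (v / 2)) (σ ^ 2 * (2 * v)) (by positivity)
  obtain ⟨C2, hC2⟩ := hasExpDecay_heatKernelTwo (σ ^ 2 * (v / 2)) (σ ^ 2 * (2 * v)) (by positivity)
  have hpos : ∀ p ∈ Ioo (v / 2) (2 * v), 0 < p := fun p hp => (half_pos hv).trans hp.1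
  have hτp : ∀ p ∈ Ioo (v / 2) (2 * v), 0 < σ ^ 2 * p := fun p hp => mul_pos hσ2 (hpos p hp)
  have hlo : ∀ p ∈ Ioo (v / 2) (2 * v), σ ^ 2 * (v / 2) ≤ σ ^ 2 * p :=
    fun p hp => mul_le_mul_of_nonneg_left hp.1.le hσ2.le
  have hhi : ∀ p ∈ Ioo (v / 2) (2 * v), σ ^ 2 * p ≤ σ ^ 2 * (2 * v) :=
    fun p hp => mul_le_mul_of_nonneg_left hp.2.le hσ2.le
  refine hasDerivAt_integral_of_expDecay hh hb (x := fun p => c + a * p)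
    (X := |c| + |a| * (2 * v)) (C := max C0 (σ ^ 2 / 2 * C2 + |a| * C1))
    (s := Ioo (v / 2) (2 * v)) (K := fun p y => heatKernel (σ ^ 2 * p) (y - (c + a * p)))
    (K' := fun p y => σ ^ 2 / 2 * heatKernelTwo (σ ^ 2 * p) (y - (c + a * p)) +
        a * heatKernelOne (σ ^ 2 * p) (y - (c + a * p)))
    (Ioo_mem_nhds (half_lt_self hv) (by linarith)) (fun p hp => ?_) (fun p hp y => ?_)
    (fun p hp y => ?_) (fun p hp => ?_) (fun p hp => ?_) (fun p hp y => ?_)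
  · refine (abs_add_le _ _).trans (add_le_add_right ?_ _)
    rw [abs_mul, abs_of_pos (hpos p hp)]
    exact mul_le_mul_of_nonneg_left hp.2.le (abs_nonneg _)
  · exact (hC0 _ (hlo p hp) (hhi p hp) _).trans
      (mul_le_mul_of_nonneg_right (le_max_left _ _) (Real.exp_pos _).le)
  · refine le_trans ?_ (mul_le_mul_of_nonneg_right (le_max_right _ _) (Real.exp_pos _).le)
    refine (abs_add_le _ _).trans ?_
    rw [abs_mul, abs_mul, abs_of_pos (half_pos hσ2), add_mul, mul_assoc, mul_assoc]
    exact add_le_add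
      (mul_le_mul_of_nonneg_left (hC2 _ (hlo p hp) (hhi p hp) _) (half_pos hσ2).le)
      (mul_le_mul_of_nonneg_left (hC1 _ (hlo p hp) (hhi p hp) _) (abs_nonneg a))
  · exact continuousOn_heatKernel.comp_continuous
      (by fun_prop : Continuous fun y : ℝ => (σ ^ 2 * p, y - (c + a * p))) fun _ => hτp p hp
  · exact (continuous_const.mul (continuousOn_heatKernelTwo.comp_continuous
      (by fun_prop : Continuous fun y : ℝ => (σ ^ 2 * p, y - (c + a * p))) fun _ => hτp p hp)).add
      (continuous_const.mul (continuousOn_heatKernelOne.comp_continuous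
      (by fun_prop : Continuous fun y : ℝ => (σ ^ 2 * p, y - (c + a * p))) fun _ => hτp p hp))
  · have h1 : HasDerivAt (fun p : ℝ => σ ^ 2 * p) (σ ^ 2) p := by
      simpa using (hasDerivAt_id p).const_mul (σ ^ 2)
    have h2 : HasDerivAt (fun p : ℝ => y - (c + a * p)) (-a) p := by
      simpa using (((hasDerivAt_id p).const_mul a).const_add c).const_sub y
    exact (hasDerivAt_heatKernel h1 h2 (hτp p hp)).congr_deriv (by ring)

/-! ### Smoothing of Lipschitz payoffs by the Black–Scholes semigroup. -/

/-- A continuous family of payoffs, each 1-Lipschitz and vanishing at zero. -/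
structure IsLipschitzPayoff (G : ℝ → ℝ → ℝ) : Prop where
  continuous : Continuous fun q : ℝ × ℝ => G q.1 q.2
  lipschitz : ∀ u x y, |G u x - G u y| ≤ |x - y|
  zero : ∀ u, G u 0 = 0

namespace IsLipschitzPayoff

variable {G : ℝ → ℝ → ℝ}

lemma abs_le (hG : IsLipschitzPayoff G) (u x : ℝ) : |G u x| ≤ |x| := by
  simpa [hG.zero] using hG.lipschitz u x 0

lemma abs_le_one_add (hG : IsLipschitzPayoff G) (u x : ℝ) : |G u x| ≤ 1 * (1 + |x|) := by
  linarith [hG.abs_le u x]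

lemma continuous_right (hG : IsLipschitzPayoff G) (u : ℝ) : Continuous (G u) :=
  hG.continuous.comp (by fun_prop : Continuous fun x : ℝ => (u, x))

lemma abs_exp_le (hG : IsLipschitzPayoff G) (u y : ℝ) : |G u (Real.exp y)| ≤ Real.exp y := by
  simpa [abs_of_pos (Real.exp_pos y)] using hG.abs_le u (Real.exp y)

end IsLipschitzPayoff

/-- The discounted expectation of a payoff `g` after a time `v`. -/
noncomputable def discountedMean (r σ : ℝ) (g : ℝ → ℝ) (v s : ℝ) : ℝ :=
  Real.exp (-r * v) * gbmMean r σ g v s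

/-- The discounted expectation of a Lipschitz payoff is smooth at positive times, solves the
Black--Scholes equation, and its second spatial derivative has an integrable singularity. -/
theorem exists_deriv_discountedMean {G : ℝ → ℝ → ℝ} (hG : IsLipschitzPayoff G) (r : ℝ) {σ : ℝ}
    (hσ : 0 < σ) : ∃ D₁ D₂ : ℝ → ℝ → ℝ → ℝ,
      (∀ u v s, 0 < v → 0 < s →
        HasDerivAt (fun s => discountedMean r σ (G u) v s) (D₁ u v s) s) ∧
      (∀ u v s, 0 < v → 0 < s → HasDerivAt (fun s => D₁ u v s) (D₂ u v s) s) ∧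
      (∀ u v s, 0 < v → 0 < s → HasDerivAt (fun v => discountedMean r σ (G u) v s)
        (r * s * D₁ u v s + 1 / 2 * σ ^ 2 * s ^ 2 * D₂ u v s
          - r * discountedMean r σ (G u) v s) v) ∧
      ContinuousOn (fun q : ℝ × ℝ × ℝ => D₁ q.1 q.2.1 q.2.2) {q | 0 < q.2.1 ∧ 0 < q.2.2} ∧
      ContinuousOn (fun q : ℝ × ℝ × ℝ => D₂ q.1 q.2.1 q.2.2) {q | 0 < q.2.1 ∧ 0 < q.2.2} ∧
      ∀ V a b, 0 < a → ∃ C, 0 ≤ C ∧ ∀ u v s, 0 < v → v ≤ V → a ≤ s → s ≤ b →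
        |D₁ u v s| ≤ C / Real.sqrt v ∧ |D₂ u v s| ≤ C / Real.sqrt v := by
  have hσ2 : 0 < σ ^ 2 := by positivity
  set α := r - σ ^ 2 / 2 with hα
  set X : ℝ → ℝ → ℝ := fun v s => Real.log s + α * v with hX
  set I : (ℝ → ℝ → ℝ) → ℝ → ℝ → ℝ → ℝ := fun κ u v s =>
    ∫ y, G u (Real.exp y) * κ (σ ^ 2 * v) (y - X v s) with hI
  have hc : ∀ u, Continuous fun y => G u (Real.exp y) := fun u =>
    (hG.continuous_right u).comp Real.continuous_exp
  have hb : ∀ u y, |G u (Real.exp y)| ≤ Real.exp y := hG.abs_exp_le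
  have hmean : ∀ u v s, 0 < v → 0 < s →
      discountedMean r σ (G u) v s = Real.exp (-r * v) * I heatKernel u v s := fun u v s hv hs => by
    rw [discountedMean, gbmMean_eq_integral_heatKernel r hσ (G u) hv hs]
  have hlog : ∀ v s, 0 < s → HasDerivAt (fun s => X v s) s⁻¹ s := fun v s hs =>
    (Real.hasDerivAt_log hs.ne').add_const _
  have hI0 : ∀ u v s, 0 < v → 0 < s →
      HasDerivAt (fun s => I heatKernel u v s) (I heatKernelOne u v s * s⁻¹) s :=
    fun u v s hv hs => (hasDerivAt_integral_hasExpDecay (hc u) (hb u) hasExpDecay_heatKernel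
      hasExpDecay_heatKernelOne (fun τ hτ w => hasDerivAt_heatKernel_snd hτ w)
      continuousOn_heatKernelOne (mul_pos hσ2 hv) (X v s)).comp s (hlog v s hs)
  have hI1 : ∀ u v s, 0 < v → 0 < s →
      HasDerivAt (fun s => I heatKernelOne u v s) (I heatKernelTwo u v s * s⁻¹) s :=
    fun u v s hv hs => (hasDerivAt_integral_hasExpDecay (hc u) (hb u) hasExpDecay_heatKernelOne
      hasExpDecay_heatKernelTwo (fun τ hτ w => hasDerivAt_heatKernelOne_snd hτ w)
      continuousOn_heatKernelTwo (mul_pos hσ2 hv) (X v s)).comp s (hlog v s hs)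
  have hcont : ∀ κ, HasExpDecay κ →
      ContinuousOn (fun q : ℝ × ℝ => κ q.1 q.2) {q | 0 < q.1} →
      ContinuousOn (fun q : ℝ × ℝ × ℝ => I κ q.1 q.2.1 q.2.2) {q | 0 < q.2.1 ∧ 0 < q.2.2} := by
    rintro κ hκ hκc ⟨u, v, s⟩ ⟨hv, hs⟩
    refine ContinuousAt.continuousWithinAt ?_
    have h := continuousAt_integral_of_hasExpDecay (h := fun u y => G u (Real.exp y))
      (hG.continuous.comp (by fun_prop : Continuous fun q : ℝ × ℝ => (q.1, Real.exp q.2)))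
      hb hκ hκc u (mul_pos hσ2 hv) (X v s)
    have hl : ContinuousAt (fun q : ℝ × ℝ × ℝ => (q.1, σ ^ 2 * q.2.1, X q.2.1 q.2.2)) (u, v, s) := by
      have : ContinuousAt (fun q : ℝ × ℝ × ℝ => Real.log q.2.2) (u, v, s) :=
        (by fun_prop : Continuous fun q : ℝ × ℝ × ℝ => q.2.2).continuousAt.log (ne_of_gt hs)
      fun_prop
    exact ContinuousAt.comp (x := (u, v, s))
      (f := fun q : ℝ × ℝ × ℝ => (q.1, σ ^ 2 * q.2.1, X q.2.1 q.2.2)) h hl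
  have hexp : Continuous fun q : ℝ × ℝ × ℝ => Real.exp (-r * q.2.1) := by fun_prop
  -- Chain rule through `log s`: one derivative brings `1 / s`, and the second also hits this
  -- factor, which produces the difference of the two convolutions over `s ^ 2`.
  refine ⟨fun u v s => Real.exp (-r * v) * I heatKernelOne u v s / s, fun u v s =>
    Real.exp (-r * v) * (I heatKernelTwo u v s - I heatKernelOne u v s) / s ^ 2,
    fun u v s hv hs => ?_, fun u v s hv hs => ?_, fun u v s hv hs => ?_, ?_, ?_, ?_⟩
  · have h := (hI0 u v s hv hs).const_mul (Real.exp (-r * v))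
    refine (h.congr_of_eventuallyEq ?_).congr_deriv (by ring)
    filter_upwards [Ioi_mem_nhds hs] with s' hs'
    exact hmean u v s' hv hs'
  · have h := ((hI1 u v s hv hs).const_mul (Real.exp (-r * v))).div (hasDerivAt_id s) hs.ne'
    refine HasDerivAt.congr_deriv h ?_
    simp only [id]
    field_simp
  · have hi1 : Integrable fun y => G u (Real.exp y) * heatKernelOne (σ ^ 2 * v) (y - X v s) := by
      obtain ⟨C, hC⟩ := hasExpDecay_heatKernelOne (σ ^ 2 * v) (σ ^ 2 * v) (by positivity)
      refine (integrable_exp_neg_abs.const_mul (C * Real.exp (2 * |X v s|))).mono'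
        ((hc u).mul (continuousOn_heatKernelOne.comp_continuous (by fun_prop :
          Continuous fun y : ℝ => (σ ^ 2 * v, y - X v s)) fun _ => mul_pos hσ2 hv)).aestronglyMeasurable
        (Filter.Eventually.of_forall fun y =>
          abs_mul_le_exp_neg_abs (hb u y) le_rfl (hC _ le_rfl le_rfl _))
    have hi2 : Integrable fun y => G u (Real.exp y) * heatKernelTwo (σ ^ 2 * v) (y - X v s) := by
      obtain ⟨C, hC⟩ := hasExpDecay_heatKernelTwo (σ ^ 2 * v) (σ ^ 2 * v) (by positivity)
      refine (integrable_exp_neg_abs.const_mul (C * Real.exp (2 * |X v s|))).mono'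
        ((hc u).mul (continuousOn_heatKernelTwo.comp_continuous (by fun_prop :
          Continuous fun y : ℝ => (σ ^ 2 * v, y - X v s)) fun _ => mul_pos hσ2 hv)).aestronglyMeasurable
        (Filter.Eventually.of_forall fun y =>
          abs_mul_le_exp_neg_abs (hb u y) le_rfl (hC _ le_rfl le_rfl _))
    have h1 : HasDerivAt (fun v => I heatKernel u v s)
        (σ ^ 2 / 2 * I heatKernelTwo u v s + α * I heatKernelOne u v s) v := by
      refine (hasDerivAt_integral_heatKernel_time (hc u) (hb u) hσ α (Real.log s) hv).congr_deriv ?_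
      simp only [hI, ← integral_const_mul]
      rw [← integral_add (hi2.const_mul _) (hi1.const_mul _)]
      congr 1
      ext y
      simp only [hX]
      ring
    have h2 : HasDerivAt (fun v => Real.exp (-r * v)) (Real.exp (-r * v) * -r) v := by
      simpa using ((hasDerivAt_id v).const_mul (-r)).exp
    refine ((h2.mul h1).congr_of_eventuallyEq ?_).congr_deriv ?_
    · filter_upwards [Ioi_mem_nhds hv] with v' hv'
      exact hmean u v' s hv' hs
    -- The term `-σ ^ 2 / 2` in the drift `α` is matched by the first-order part of `D₂`; the
    -- derivative of the discount factor gives the zeroth-order term.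
    · rw [hmean u v s hv hs, hα]
      field_simp
      ring
  · exact (hexp.continuousOn.mul (hcont _ hasExpDecay_heatKernelOne continuousOn_heatKernelOne)).div
      (by fun_prop) fun q hq => ne_of_gt hq.2
  · exact (hexp.continuousOn.mul ((hcont _ hasExpDecay_heatKernelTwo continuousOn_heatKernelTwo).sub
      (hcont _ hasExpDecay_heatKernelOne continuousOn_heatKernelOne))).div
      (by fun_prop) fun q hq => pow_ne_zero 2 (ne_of_gt hq.2)
  · intro V a b ha
    set M₁ := ∫ z, |z| ^ 1 * Real.exp (Real.sqrt (σ ^ 2 * V) * |z|) ∂(gaussianReal 0 1) with hM₁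
    set M₂ := ∫ z, (|z| ^ 3 * Real.exp (Real.sqrt (σ ^ 2 * V) * |z|) +
      |z| ^ 1 * Real.exp (Real.sqrt (σ ^ 2 * V) * |z|)) ∂(gaussianReal 0 1) with hM₂
    have hM₁0 : 0 ≤ M₁ := integral_nonneg fun z => by positivity
    have hM₂0 : 0 ≤ M₂ := integral_nonneg fun z => by positivity
    -- The factors bound the discount factor, `exp (X v s)`, the `1 / σ` from `√(σ ^ 2 * v)`, and
    -- the Gaussian moments. The powers of `a` below bound the powers of `1 / s`.
    set E := Real.exp (|r| * V) * (|b| * Real.exp (|α| * V)) / σ * (M₂ + M₁)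
    refine ⟨max (E / a) (E / a ^ 2), by positivity, fun u v s hv hvV has hsb => ?_⟩
    have hs : 0 < s := ha.trans_le has
    have hsv : 0 < Real.sqrt v := Real.sqrt_pos.2 hv
    have hτ : 0 < σ ^ 2 * v := by positivity
    have hτV : σ ^ 2 * v ≤ σ ^ 2 * V := by gcongr
    have hsq : Real.sqrt (σ ^ 2 * v) = σ * Real.sqrt v := by
      rw [Real.sqrt_mul hσ2.le, Real.sqrt_sq hσ.le]
    have he : Real.exp (X v s) ≤ |b| * Real.exp (|α| * V) := by
      rw [hX, Real.exp_add, Real.exp_log hs]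
      refine mul_le_mul ?_ (Real.exp_le_exp.2 ?_) (Real.exp_pos _).le (abs_nonneg b)
      · exact hsb.trans (le_abs_self b)
      · exact mul_le_abs_mul α hv.le hvV
    have hr : Real.exp (-r * v) ≤ Real.exp (|r| * V) := by
      simpa using mul_le_abs_mul (-r) hv.le hvV
    have b1 : |I heatKernelOne u v s| ≤
        (|b| * Real.exp (|α| * V)) / (σ * Real.sqrt v) * M₁ := by
      refine (abs_integral_heatKernelOne_le (hb u) hτ hτV (X v s)).trans ?_
      rw [hsq, ← hM₁]
      gcongr
    have b2 : |I heatKernelTwo u v s| ≤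
        (|b| * Real.exp (|α| * V)) / (σ * Real.sqrt v) * M₂ := by
      refine (abs_integral_heatKernelTwo_le (hc u) (hb u)
        (fun y x => hG.lipschitz u _ _) hτ hτV (X v s)).trans ?_
      rw [hsq, ← hM₂]
      gcongr
    have b3 : ∀ J, |J| ≤ (|b| * Real.exp (|α| * V)) / (σ * Real.sqrt v) * (M₂ + M₁) →
        |Real.exp (-r * v) * J| ≤ E / Real.sqrt v := fun J hJ => by
      rw [abs_mul, abs_of_pos (Real.exp_pos _)]
      calc _ ≤ Real.exp (|r| * V) *
            ((|b| * Real.exp (|α| * V)) / (σ * Real.sqrt v) * (M₂ + M₁)) := by gcongr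
        _ = _ := by simp only [E]; field_simp
    constructor
    · rw [abs_div, abs_of_pos hs]
      calc _ ≤ (E / Real.sqrt v) / a := by
            gcongr
            refine b3 _ (b1.trans ?_)
            gcongr
            linarith
        _ = (E / a) / Real.sqrt v := by ring
        _ ≤ _ := by gcongr; exact le_max_left _ _
    · rw [abs_div, abs_of_pos (pow_pos hs 2)]
      calc _ ≤ (E / Real.sqrt v) / a ^ 2 := by
            gcongr
            refine b3 _ ((abs_sub _ _).trans ((add_le_add b2 b1).trans_eq ?_))
            ring
        _ = (E / a ^ 2) / Real.sqrt v := by ring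
        _ ≤ _ := by gcongr; exact le_max_right _ _

/-! ### Duhamel integrals with an integrable singularity. -/

lemma integrableOn_div_sqrt (C V : ℝ) :
    IntegrableOn (fun v : ℝ => C / Real.sqrt v) (Ioc 0 V) := by
  rcases le_total V 0 with hV | hV
  · simp [Ioc_eq_empty_of_le hV]
  have h := (intervalIntegral.intervalIntegrable_rpow' (a := 0) (b := V)
    (by norm_num : (-1 : ℝ) < -(1 / 2))).const_mul C
  rw [intervalIntegrable_iff_integrableOn_Ioc_of_le hV] at h
  refine h.congr_fun (fun v hv => ?_) measurableSet_Ioc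
  simp only [Real.rpow_neg hv.1.le, Real.sqrt_eq_rpow, div_eq_mul_inv]

/-- Continuity of an integral with respect to a parameter and to its upper end point. -/
lemma continuousWithinAt_integral_of_dominated {X : Type*} [TopologicalSpace X]
    [FirstCountableTopology X] {ℓ : X → ℝ} {b : X → ℝ → ℝ} {S : Set X} {x₀ : X} {V : ℝ}
    {bound : ℝ → ℝ} (hx₀ : x₀ ∈ S) (hℓ : ContinuousWithinAt ℓ S x₀)
    (hℓV : ∀ x ∈ S, 0 ≤ ℓ x ∧ ℓ x ≤ V)
    (hm : ∀ x ∈ S, AEStronglyMeasurable (b x) (volume.restrict (Ioc 0 V)))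
    (hb : ∀ᶠ x in nhdsWithin x₀ S, ∀ v ∈ Ioc 0 V, |b x v| ≤ bound v)
    (hbi : IntegrableOn bound (Ioc 0 V))
    (hc : ∀ v ∈ Ioc 0 V, ContinuousWithinAt (fun x => b x v) S x₀) :
    ContinuousWithinAt (fun x => ∫ v in (0 : ℝ)..ℓ x, b x v) S x₀ := by
  have key : ∀ x ∈ S, ∫ v in (0 : ℝ)..ℓ x, b x v =
      ∫ v in Ioc 0 V, (Ioc 0 (ℓ x)).indicator (b x) v := fun x hx => by
    rw [intervalIntegral.integral_of_le (hℓV x hx).1, setIntegral_indicator measurableSet_Ioc,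
      inter_eq_self_of_subset_right (Ioc_subset_Ioc_right (hℓV x hx).2)]
  refine ContinuousWithinAt.congr ?_ key (key x₀ hx₀)
  refine continuousWithinAt_of_dominated (bound := bound) ?_ ?_ hbi ?_
  · filter_upwards [self_mem_nhdsWithin] with x hx
    exact (hm x hx).indicator measurableSet_Ioc
  · filter_upwards [hb] with x hx
    refine (ae_restrict_iff' measurableSet_Ioc).2 (Filter.Eventually.of_forall fun v hv => ?_)
    exact (norm_indicator_le_norm_self _ _).trans (hx v hv)
  -- The indicator of the moving interval can jump in the limit only at its end point, a null set.
  · have hne : ∀ᵐ v : ℝ ∂volume, v ≠ ℓ x₀ := by simp [ae_iff, measure_singleton]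
    filter_upwards [ae_restrict_mem measurableSet_Ioc, ae_restrict_of_ae hne] with v hv hvne
    rcases lt_or_gt_of_ne hvne with h | h
    · refine (hc v hv).congr_of_eventuallyEq ?_ ?_
      · filter_upwards [hℓ.eventually_const_lt h] with x hx
        simp [hv.1, hx.le]
      · simp [hv.1, h.le]
    · refine (continuousWithinAt_const (b := (0 : ℝ))).congr_of_eventuallyEq ?_ ?_
      · filter_upwards [hℓ.eventually_lt_const h] with x hx
        simp [hx]
      · simp [h]

lemma intervalIntegrable_of_le_div_sqrt {b : ℝ → ℝ} {C V : ℝ} (hV : 0 ≤ V)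
    (hm : ContinuousOn b (Ioi 0)) (hb : ∀ v, 0 < v → v ≤ V → |b v| ≤ C / Real.sqrt v) :
    IntervalIntegrable b volume 0 V := by
  rw [intervalIntegrable_iff_integrableOn_Ioc_of_le hV]
  refine (integrableOn_div_sqrt C V).mono'
    ((hm.mono Ioc_subset_Ioi_self).aestronglyMeasurable measurableSet_Ioc) ?_
  exact (ae_restrict_iff' measurableSet_Ioc).2
    (Filter.Eventually.of_forall fun v hv => hb v hv.1 hv.2)

/-- Fubini on the triangle `t < τ < u ≤ T` with `τ = u - v`: integrating over `τ` first gives one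
side, over `u` first the other. -/
lemma integral_integral_triangle {Φ' : ℝ → ℝ → ℝ} {C T t : ℝ} (ht : 0 ≤ t) (htT : t ≤ T)
    (hc : ContinuousOn (fun q : ℝ × ℝ => Φ' q.1 q.2) {q | 0 < q.2})
    (hb : ∀ u v, 0 < v → v ≤ T → |Φ' u v| ≤ C / Real.sqrt v) :
    IntervalIntegrable (fun u => ∫ v in (0 : ℝ)..(u - t), Φ' u v) volume t T ∧
    ∫ u in t..T, ∫ v in (0 : ℝ)..(u - t), Φ' u v =
      ∫ τ in t..T, ∫ v in (0 : ℝ)..(T - τ), Φ' (τ + v) v := by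
  set A : Set (ℝ × ℝ) := {p | t < p.2 ∧ p.2 < p.1 ∧ p.1 ≤ T} with hA
  have hAm : MeasurableSet A :=
    (measurableSet_lt measurable_const measurable_snd).inter
      ((measurableSet_lt measurable_snd measurable_fst).inter
        (measurableSet_le measurable_fst measurable_const))
  set k : ℝ → ℝ → ℝ := fun u τ => A.indicator (fun p => Φ' p.1 (p.1 - p.2)) (u, τ) with hk
  have hki : Integrable (Function.uncurry k) (volume.prod volume) := by
    have hf : Integrable ((Ioc (0 : ℝ) T).indicator fun _ => (1 : ℝ)) :=
      (integrable_indicator_iff measurableSet_Ioc).2 (integrableOn_const (by simp))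
    have hg : Integrable ((Ioc (0 : ℝ) T).indicator fun v => C / Real.sqrt v) :=
      (integrable_indicator_iff measurableSet_Ioc).2 (integrableOn_div_sqrt C T)
    -- The integrand is at most `C / √(u - τ)` on the triangle, hence dominated by the convolution
    -- integrand of two integrable functions on `(0, T]`.
    refine (hf.convolution_integrand (ContinuousLinearMap.mul ℝ ℝ) hg).mono' ?_ ?_
    · have : AEStronglyMeasurable (A.indicator fun p : ℝ × ℝ => Φ' p.1 (p.1 - p.2))
          (volume.prod volume) := by
        rw [aestronglyMeasurable_indicator_iff hAm]
        refine ContinuousOn.aestronglyMeasurable ?_ hAm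
        exact hc.comp (by fun_prop : Continuous fun p : ℝ × ℝ => (p.1, p.1 - p.2)).continuousOn
          fun p hp => sub_pos.2 hp.2.1
      exact this
    · refine Filter.Eventually.of_forall fun p => ?_
      simp only [Function.uncurry, hk, ContinuousLinearMap.mul_apply']
      by_cases hp : p ∈ A
      · have h1 : p.2 ∈ Ioc 0 T := ⟨ht.trans_lt hp.1, hp.2.1.le.trans hp.2.2⟩
        have h2 : p.1 - p.2 ∈ Ioc 0 T := ⟨sub_pos.2 hp.2.1, by linarith [hp.2.2, h1.1]⟩
        rw [indicator_of_mem hp, indicator_of_mem h1, indicator_of_mem h2, one_mul]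
        exact hb _ _ h2.1 h2.2
      · rw [indicator_of_notMem hp, norm_zero]
        have hC : 0 ≤ (Ioc (0 : ℝ) T).indicator (fun v => C / Real.sqrt v) (p.1 - p.2) :=
          indicator_nonneg (fun v hv => (abs_nonneg _).trans (hb 0 v hv.1 hv.2)) _
        exact mul_nonneg (indicator_nonneg (fun _ _ => zero_le_one) _) hC
  have hleft : (fun u => ∫ τ, k u τ) =
      (Ioc t T).indicator fun u => ∫ v in (0 : ℝ)..(u - t), Φ' u v := by
    ext u
    by_cases hu : u ∈ Ioc t T
    · have : k u = (Ioo t u).indicator fun τ => Φ' u (u - τ) := by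
        ext τ
        simp only [hk, indicator, hA, mem_ofPred_eq, mem_Ioo]
        simp [hu.2]
      rw [indicator_of_mem hu, this, integral_indicator measurableSet_Ioo,
        ← integral_Ioc_eq_integral_Ioo, ← intervalIntegral.integral_of_le hu.1.le,
        intervalIntegral.integral_comp_sub_left (fun v => Φ' u v)]
      simp
    · have : k u = 0 := by
        ext τ
        refine indicator_of_notMem (fun h => hu ⟨h.1.trans h.2.1, h.2.2⟩) _
      rw [indicator_of_notMem hu, this]
      simp
  have hright : (fun τ => ∫ u, k u τ) =
      (Ioc t T).indicator fun τ => ∫ v in (0 : ℝ)..(T - τ), Φ' (τ + v) v := by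
    ext τ
    by_cases hτ : τ ∈ Ioc t T
    · have : (fun u => k u τ) = (Ioc τ T).indicator fun u => Φ' u (u - τ) := by
        ext u
        simp only [hk, indicator, hA, mem_ofPred_eq, mem_Ioc]
        simp [hτ.1]
      rw [indicator_of_mem hτ, this, integral_indicator measurableSet_Ioc,
        ← intervalIntegral.integral_of_le hτ.2]
      have h := intervalIntegral.integral_comp_add_left (fun u => Φ' u (u - τ))
        (a := 0) (b := T - τ) τ
      simp only [add_sub_cancel_left, add_zero, add_sub_cancel] at h
      rw [h]
    · have : (fun u => k u τ) = 0 := by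
        ext u
        refine indicator_of_notMem (fun h => hτ ⟨h.1, h.2.1.le.trans h.2.2⟩) _
      rw [indicator_of_notMem hτ, this]
      simp
  constructor
  · rw [intervalIntegrable_iff_integrableOn_Ioc_of_le htT,
      ← integrable_indicator_iff measurableSet_Ioc, ← hleft]
    exact hki.integral_prod_left
  · have h := integral_integral_swap hki
    rw [hleft, hright, integral_indicator measurableSet_Ioc, integral_indicator measurableSet_Ioc,
      ← intervalIntegral.integral_of_le htT, ← intervalIntegral.integral_of_le htT] at h
    exact h

/-- Time derivative of a Duhamel integral whose integrand has an integrable singularity in its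
derivative along the diagonal. -/
theorem hasDerivAt_duhamel {Φ Φ' : ℝ → ℝ → ℝ} {C T t : ℝ} (ht : 0 < t) (htT : t < T)
    (h0 : Continuous fun u => Φ u 0) (hΦ : ∀ u, ContinuousOn (Φ u) (Ici 0))
    (hd : ∀ u v, 0 < v → HasDerivAt (Φ u) (Φ' u v) v)
    (hc : ContinuousOn (fun q : ℝ × ℝ => Φ' q.1 q.2) {q | 0 < q.2})
    (hb : ∀ u v, 0 < v → v ≤ T → |Φ' u v| ≤ C / Real.sqrt v) :
    HasDerivAt (fun t => ∫ v in (0 : ℝ)..(T - t), Φ (t + v) v)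
      (-(Φ t 0 + ∫ v in (0 : ℝ)..(T - t), Φ' (t + v) v)) t := by
  have hi : ∀ u w, 0 ≤ w → w ≤ T → IntervalIntegrable (Φ' u) volume 0 w := fun u w hw hwT =>
    intervalIntegrable_of_le_div_sqrt hw
      (hc.comp (by fun_prop : Continuous fun v : ℝ => (u, v)).continuousOn fun v hv => hv)
      fun v hv hvw => hb u v hv (hvw.trans hwT)
  -- Minus the expected derivative: the boundary value at zero delay plus the accumulated change in
  -- the delay variable.
  set κ : ℝ → ℝ := fun τ => Φ τ 0 + ∫ v in (0 : ℝ)..(T - τ), Φ' (τ + v) v with hκ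
  have hint : ContinuousOn (fun τ => ∫ v in (0 : ℝ)..(T - τ), Φ' (τ + v) v) (Icc 0 T) := by
    intro τ hτ
    refine continuousWithinAt_integral_of_dominated (V := T) hτ (by fun_prop)
      (fun x hx => ⟨by linarith [hx.2], by linarith [hx.1]⟩) (fun x _ => ?_)
      (Filter.Eventually.of_forall fun x v hv => hb (x + v) v hv.1 hv.2)
      (integrableOn_div_sqrt C T) fun v hv => ?_
    · refine ContinuousOn.aestronglyMeasurable ?_ measurableSet_Ioc
      exact hc.comp (by fun_prop : Continuous fun v : ℝ => (x + v, v)).continuousOn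
        fun v hv => hv.1
    · exact (hc.comp_continuous (by fun_prop : Continuous fun x : ℝ => (x + v, v))
        fun _ => hv.1).continuousWithinAt
  have hκc : ContinuousOn κ (Icc 0 T) := h0.continuousOn.add hint
  -- With `u = τ + v`, expand `Φ u (u - τ)` from delay zero and exchange the integrals. After this
  -- `τ` occurs only as an end point, so `Φ` is never differentiated in its first variable.
  have hJ : ∀ τ ∈ Icc 0 T, ∫ v in (0 : ℝ)..(T - τ), Φ (τ + v) v = ∫ x in τ..T, κ x := by
    intro τ hτ
    obtain ⟨hti, htri⟩ := integral_integral_triangle hτ.1 hτ.2 hc hb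
    have h1 := intervalIntegral.integral_comp_add_left (fun u => Φ u (u - τ))
      (a := 0) (b := T - τ) τ
    simp only [add_sub_cancel_left, add_zero, add_sub_cancel] at h1
    rw [h1, hκ, intervalIntegral.integral_add (h0.intervalIntegrable _ _)
      ((hint.mono (Icc_subset_Icc_left hτ.1)).intervalIntegrable_of_Icc hτ.2), ← htri,
      ← intervalIntegral.integral_add (h0.intervalIntegrable _ _) hti]
    refine intervalIntegral.integral_congr fun u hu => ?_
    rw [uIcc_of_le hτ.2] at hu
    have h2 := intervalIntegral.integral_eq_sub_of_hasDerivAt_of_le (sub_nonneg.2 hu.1)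
      ((hΦ u).mono Icc_subset_Ici_self) (fun v hv => hd u v hv.1)
      (hi u (u - τ) (sub_nonneg.2 hu.1) (by linarith [hu.2, hτ.1]))
    rw [h2]
    ring
  have hκt : ContinuousAt κ t := hκc.continuousAt (Icc_mem_nhds ht htT)
  have h := intervalIntegral.integral_hasDerivAt_left
    ((hκc.mono (Icc_subset_Icc_left ht.le)).intervalIntegrable_of_Icc htT.le)
    ((hκc.mono Ioo_subset_Icc_self).stronglyMeasurableAtFilter isOpen_Ioo t ⟨ht, htT⟩) hκt
  refine h.congr_of_eventuallyEq ?_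
  filter_upwards [Icc_mem_nhds ht htT] with τ hτ
  exact hJ τ hτ

/-! ### Holding-time laws and the Volterra operator. -/

namespace SemiMarkovMarket

variable {k : ℕ}

section HoldingTimes

variable (M : SemiMarkovMarket k) (i : Fin k)

lemma F_zero : M.F i 0 = 0 := by
  have := M.holdingLaw_prob i
  rw [F, cdf_eq_real, Measure.real, M.holdingLaw_Iic_zero]
  simp

lemma f_pos {y : ℝ} (hy : 0 < y) : 0 < M.f i y := by
  refine lt_of_le_of_ne ?_ (M.f_ne_zero i y hy).symm
  rw [← (M.hasDerivAt_cdf i y hy).deriv]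
  exact (monotone_cdf _).deriv_nonneg

/-- Had the distribution function reached one, it would be constant from there on and its density
would vanish. This keeps the denominators `1 - F` positive. -/
lemma F_lt_one {y : ℝ} (hy : 0 ≤ y) : M.F i y < 1 := by
  refine lt_of_le_of_ne (cdf_le_one _ _) fun h => ?_
  have h1 : ∀ z, y ≤ z → cdf (M.holdingLaw i) z = 1 := fun z hz =>
    le_antisymm (cdf_le_one _ _) (h.symm.le.trans (monotone_cdf _ hz))
  have h2 : HasDerivAt (fun u => cdf (M.holdingLaw i) u) 0 (y + 1) := by
    refine (hasDerivAt_const (y + 1) (1 : ℝ)).congr_of_eventuallyEq ?_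
    filter_upwards [Ioi_mem_nhds (lt_add_one y)] with z hz
    exact h1 z (le_of_lt hz)
  exact M.f_ne_zero i (y + 1) (by linarith) ((M.hasDerivAt_cdf i _ (by linarith)).unique h2)

lemma one_sub_F_pos {y : ℝ} (hy : 0 ≤ y) : 0 < 1 - M.F i y := sub_pos.2 (M.F_lt_one i hy)

lemma hasDerivAt_F {y : ℝ} (hy : 0 < y) : HasDerivAt (M.F i) (M.f i y) y :=
  M.hasDerivAt_cdf i y hy

lemma continuousOn_F : ContinuousOn (M.F i) (Ici 0) := by
  intro y hy
  rcases eq_or_lt_of_le (show (0 : ℝ) ≤ y from hy) with rfl | h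
  · exact (cdf (M.holdingLaw i)).right_continuous 0
  · exact (M.hasDerivAt_F i h).continuousAt.continuousWithinAt

lemma continuousOn_f : ContinuousOn (M.f i) (Ioi 0) := (M.f_contDiff i).continuousOn

lemma hasDerivAt_f {y : ℝ} (hy : 0 < y) : HasDerivAt (M.f i) (deriv (M.f i) y) y :=
  (((M.f_contDiff i).differentiableOn one_ne_zero).differentiableAt
    (Ioi_mem_nhds hy)).hasDerivAt

lemma continuousOn_deriv_f : ContinuousOn (deriv (M.f i)) (Ioi 0) :=
  (M.f_contDiff i).continuousOn_deriv_of_isOpen isOpen_Ioi le_rfl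

lemma intervalIntegrable_f {τ : ℝ} (hτ : 0 ≤ τ) : IntervalIntegrable (M.f i) volume 0 τ := by
  obtain ⟨C, hC⟩ := M.f_bounded i
  rw [intervalIntegrable_iff_integrableOn_Ioc_of_le hτ]
  refine (integrableOn_const (C := C) (by simp)).mono' (((M.continuousOn_f i).mono
    Ioc_subset_Ioi_self).aestronglyMeasurable measurableSet_Ioc) ?_
  exact (ae_restrict_iff' measurableSet_Ioc).2
    (Filter.Eventually.of_forall fun v hv => hC v hv.1)

/-- Right continuity of `F` together with the absence of mass at zero carries the fundamental
theorem down to the end point, where `f` itself may have no limit. -/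
lemma integral_f {τ : ℝ} (hτ : 0 ≤ τ) : ∫ v in (0 : ℝ)..τ, M.f i v = M.F i τ := by
  rw [intervalIntegral.integral_eq_sub_of_hasDerivAt_of_le hτ
    ((M.continuousOn_F i).mono Icc_subset_Ici_self) (fun v hv => M.hasDerivAt_F i hv.1)
    (M.intervalIntegrable_f i hτ), M.F_zero, sub_zero]

end HoldingTimes

/-- The average of the payoffs `G j` over the regime `j` entered from the regime `i`. -/
noncomputable def mix (M : SemiMarkovMarket k) (G : Fin k → ℝ → ℝ → ℝ) (i : Fin k) (u x : ℝ) : ℝ :=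
  ∑ j, M.p i j * G j u x

/-- The right-hand side of the Volterra equation, as a function of the prices `G j` at the times of
jumps. -/
noncomputable def volterra (M : SemiMarkovMarket k) (T K : ℝ) (G : Fin k → ℝ → ℝ → ℝ) (t s : ℝ)
    (i : Fin k) (y : ℝ) : ℝ :=
  ((1 - M.F i (T - t + y)) * blackScholesCall T K (M.r i) (M.σ i) t s +
    ∫ v in (0 : ℝ)..(T - t),
      M.f i (y + v) * discountedMean (M.r i) (M.σ i) (M.mix G i (t + v)) v s) / (1 - M.F i y)

end SemiMarkovMarket

/-! ### Growth and Lipschitz bounds for discounted expectations. -/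

lemma isLipschitzPayoff_call {K : ℝ} (hK : 0 < K) :
    IsLipschitzPayoff fun _ x => max (x - K) 0 where
  continuous := by fun_prop
  lipschitz _ x y := (abs_max_sub_max_le_abs _ _ _).trans_eq (by congr 1; ring)
  zero _ := max_eq_right (by linarith)

lemma blackScholesCall_eq (T K r σ t s : ℝ) :
    blackScholesCall T K r σ t s = discountedMean r σ (fun x => max (x - K) 0) (T - t) s := rfl

lemma continuous_discountedMean {G : ℝ → ℝ → ℝ} (hG : Continuous fun q : ℝ × ℝ => G q.1 q.2)
    {C : ℝ} (hC : ∀ u x, |G u x| ≤ C * (1 + |x|)) (r σ : ℝ) :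
    Continuous fun q : ℝ × ℝ × ℝ => discountedMean r σ (G q.1) q.2.1 q.2.2 :=
  Continuous.mul (by fun_prop) (continuous_gbmMean hG hC r σ)

/-- Discounting cancels the growth of the linear part exactly. The constant part keeps its discount
factor, which may exceed one since `r` can be negative. -/
lemma abs_discountedMean_le {g : ℝ → ℝ} {A B r σ v s : ℝ} (hs : 0 ≤ s)
    (hC : ∀ x, 0 ≤ x → |g x| ≤ A + B * x) (hv : 0 ≤ v) :
    |discountedMean r σ g v s| ≤ A * Real.exp (-r * v) + B * s := by
  rw [discountedMean, abs_mul, abs_of_pos (Real.exp_pos _)]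
  refine (mul_le_mul_of_nonneg_left (abs_gbmMean_le hs hC hv) (Real.exp_pos _).le).trans_eq ?_
  have : Real.exp (-r * v) * Real.exp (r * v) = 1 := by rw [← Real.exp_add]; simp
  linear_combination (B * s) * this

lemma abs_discountedMean_sub_le {g : ℝ → ℝ} (hg : Continuous g) {C : ℝ}
    (hC : ∀ x, |g x| ≤ C * (1 + |x|)) (hL : ∀ x y, 0 ≤ x → 0 ≤ y → |g x - g y| ≤ |x - y|)
    {r σ v s s' : ℝ} (hs : 0 ≤ s) (hs' : 0 ≤ s') (hv : 0 ≤ v) :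
    |discountedMean r σ g v s - discountedMean r σ g v s'| ≤ |s - s'| := by
  rw [discountedMean, discountedMean, ← mul_sub, abs_mul, abs_of_pos (Real.exp_pos _)]
  refine (mul_le_mul_of_nonneg_left (abs_gbmMean_sub_le hg hC hL hs hs' hv)
    (Real.exp_pos _).le).trans_eq ?_
  have : Real.exp (-r * v) * Real.exp (r * v) = 1 := by rw [← Real.exp_add]; simp
  linear_combination |s - s'| * this

lemma discountedMean_sub {g g' : ℝ → ℝ} (hg : Continuous g) (hg' : Continuous g') {C C' : ℝ}
    (hC : ∀ x, |g x| ≤ C * (1 + |x|)) (hC' : ∀ x, |g' x| ≤ C' * (1 + |x|)) (r σ v s : ℝ) :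
    discountedMean r σ (fun x => g x - g' x) v s =
      discountedMean r σ g v s - discountedMean r σ g' v s := by
  rw [discountedMean, gbmMean_sub hg hg' hC hC', mul_sub, discountedMean, discountedMean]

lemma discountedMean_zero_left (g : ℝ → ℝ) (r σ s : ℝ) : discountedMean r σ g 0 s = g s := by
  simp [discountedMean, gbmMean_zero_left]

lemma discountedMean_zero_right {g : ℝ → ℝ} (h : g 0 = 0) (r σ v : ℝ) :
    discountedMean r σ g v 0 = 0 := by
  simp [discountedMean, gbmMean_zero_right h]

/-- Jointly continuous families of payoffs of at most linear growth. -/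
structure HasLinearPayoffs {k : ℕ} (G : Fin k → ℝ → ℝ → ℝ) (C : ℝ) : Prop where
  continuous : ∀ j, Continuous fun q : ℝ × ℝ => G j q.1 q.2
  bound : ∀ j u x, |G j u x| ≤ C * (1 + |x|)

/-! ### Continuity, contraction and Lipschitz invariance of the Volterra operator. -/

namespace SemiMarkovMarket

variable {k : ℕ} {M : SemiMarkovMarket k} {G G' : Fin k → ℝ → ℝ → ℝ} {C C' T K : ℝ}

lemma abs_mix_le {u x B : ℝ} (h : ∀ j, |G j u x| ≤ B) (i : Fin k) : |M.mix G i u x| ≤ B := by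
  calc |M.mix G i u x| ≤ ∑ j, |M.p i j * G j u x| := Finset.abs_sum_le_sum_abs _ _
    _ ≤ ∑ j, M.p i j * B := Finset.sum_le_sum fun j _ => by
      rw [abs_mul, abs_of_nonneg (M.p_nonneg i j)]
      exact mul_le_mul_of_nonneg_left (h j) (M.p_nonneg i j)
    _ = B := by rw [← Finset.sum_mul, M.p_sum, one_mul]

lemma continuous_mix (hG : HasLinearPayoffs G C) (i : Fin k) :
    Continuous fun q : ℝ × ℝ => M.mix G i q.1 q.2 :=
  continuous_finsetSum _ fun j _ => continuous_const.mul (hG.continuous j)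

lemma continuous_mix_right (hG : HasLinearPayoffs G C) (i : Fin k) (u : ℝ) :
    Continuous (M.mix G i u) :=
  (continuous_mix hG i).comp (by fun_prop : Continuous fun x : ℝ => (u, x))

lemma abs_mix_le_linear (hG : HasLinearPayoffs G C) (i : Fin k) (u x : ℝ) :
    |M.mix G i u x| ≤ C * (1 + |x|) :=
  abs_mix_le (fun j => hG.bound j u x) i

lemma isLipschitzPayoff_mix (hG : ∀ j, IsLipschitzPayoff (G j)) (i : Fin k) :
    IsLipschitzPayoff (M.mix G i) where
  continuous := continuous_finsetSum _ fun j _ => continuous_const.mul (hG j).continuous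
  lipschitz u x y := by
    have : M.mix G i u x - M.mix G i u y = M.mix (fun j u _ => G j u x - G j u y) i u x := by
      simp only [mix, mul_sub, Finset.sum_sub_distrib]
    rw [this]
    exact abs_mix_le (fun j => (hG j).lipschitz u x y) i
  zero u := by simp [mix, (hG _).zero]

lemma continuous_discountedMean_mix (hG : HasLinearPayoffs G C) (i : Fin k) :
    Continuous fun q : ℝ × ℝ × ℝ =>
      discountedMean (M.r i) (M.σ i) (M.mix G i q.1) q.2.1 q.2.2 :=
  continuous_discountedMean (continuous_mix hG i) (abs_mix_le_linear hG i) _ _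

lemma continuousOn_duhamelIntegrand (hG : HasLinearPayoffs G C) (i : Fin k) {t s y : ℝ}
    (hy : 0 ≤ y) : ContinuousOn (fun v => M.f i (y + v) *
      discountedMean (M.r i) (M.σ i) (M.mix G i (t + v)) v s) (Ioi 0) := by
  refine ContinuousOn.mul ?_ ?_
  · exact (M.continuousOn_f i).comp (by fun_prop) fun v (hv : 0 < v) => (by
      simp only [mem_Ioi]; linarith)
  · exact ((continuous_discountedMean_mix hG i).comp
      (by fun_prop : Continuous fun v : ℝ => (t + v, v, s))).continuousOn

/-- The bound is uniform down to age zero: boundedness of `f` on the open half-line suffices because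
`v > 0` keeps `y + v` positive. -/
lemma exists_bound_duhamelIntegrand (hG : HasLinearPayoffs G C) (i : Fin k) (T S : ℝ) :
    ∃ B, ∀ t s y v, 0 ≤ y → 0 < v → v ≤ T → 0 ≤ s → s ≤ S →
      |M.f i (y + v) * discountedMean (M.r i) (M.σ i) (M.mix G i (t + v)) v s| ≤ B := by
  obtain ⟨D, hD⟩ := M.f_bounded i
  refine ⟨D * (C * Real.exp (|M.r i| * T) + C * S), fun t s y v hy hv hvT hs hsS => ?_⟩
  have hC : 0 ≤ C := by simpa using (abs_nonneg _).trans (hG.bound i 0 0)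
  have hD' := hD (y + v) (by linarith)
  have hD0 : 0 ≤ D := (abs_nonneg _).trans hD'
  rw [abs_mul]
  refine mul_le_mul hD' ?_ (abs_nonneg _) hD0
  refine (abs_discountedMean_le (A := C) (B := C) hs (fun x hx => ?_) hv.le).trans ?_
  · simpa [abs_of_nonneg hx, mul_add] using abs_mix_le_linear hG i (t + v) x
  · have : -M.r i * v ≤ |M.r i| * T := by simpa using mul_le_abs_mul (-M.r i) hv.le hvT
    gcongr

lemma intervalIntegrable_duhamelIntegrand (hG : HasLinearPayoffs G C) (i : Fin k) {t s y τ : ℝ}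
    (hy : 0 ≤ y) (hs : 0 ≤ s) (hτ : 0 ≤ τ) : IntervalIntegrable (fun v => M.f i (y + v) *
      discountedMean (M.r i) (M.σ i) (M.mix G i (t + v)) v s) volume 0 τ := by
  obtain ⟨B, hB⟩ := exists_bound_duhamelIntegrand (M := M) hG i τ s
  rw [intervalIntegrable_iff_integrableOn_Ioc_of_le hτ]
  refine (integrableOn_const (C := B) (by simp)).mono' (((continuousOn_duhamelIntegrand hG i
    hy).mono Ioc_subset_Ioi_self).aestronglyMeasurable measurableSet_Ioc) ?_
  exact (ae_restrict_iff' measurableSet_Ioc).2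
    (Filter.Eventually.of_forall fun v hv => hB t s y v hy hv.1 hv.2 hs le_rfl)

lemma continuous_blackScholesCall (hK : 0 < K) (r σ : ℝ) :
    Continuous fun q : ℝ × ℝ => blackScholesCall T K r σ q.1 q.2 :=
  (continuous_discountedMean (isLipschitzPayoff_call hK).continuous
    (isLipschitzPayoff_call hK).abs_le_one_add r σ).comp
    (by fun_prop : Continuous fun q : ℝ × ℝ => ((0 : ℝ), T - q.1, q.2))

/-- At `y = 0` the density need not extend continuously, but for each fixed `v > 0` the integrand is
continuous there, and a constant dominates it. -/
lemma continuousOn_volterra (hK : 0 < K) (hG : HasLinearPayoffs G C) (i : Fin k) :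
    ContinuousOn (fun q : ℝ × ℝ × ℝ => M.volterra T K G q.1 q.2.1 i q.2.2) (closedDomain T) := by
  have hF : ContinuousOn (fun q : ℝ × ℝ × ℝ => M.F i q.2.2) (closedDomain T) :=
    (M.continuousOn_F i).comp (by fun_prop) fun q hq => hq.2.2.2.1
  have hF' : ContinuousOn (fun q : ℝ × ℝ × ℝ => M.F i (T - q.1 + q.2.2)) (closedDomain T) :=
    (M.continuousOn_F i).comp (by fun_prop) fun q hq => by
      simp only [mem_Ici]; linarith [hq.2.1, hq.2.2.2.1]
  refine ContinuousOn.div (((continuousOn_const.sub hF').mul ((continuous_blackScholesCall hK _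
    _).comp (by fun_prop : Continuous fun q : ℝ × ℝ × ℝ => (q.1, q.2.1))).continuousOn).add ?_)
    (continuousOn_const.sub hF) fun q hq => (M.one_sub_F_pos i hq.2.2.2.1).ne'
  intro q₀ hq₀
  obtain ⟨B, hB⟩ := exists_bound_duhamelIntegrand (M := M) hG i T (q₀.2.1 + 1)
  refine continuousWithinAt_integral_of_dominated (V := T) (bound := fun _ => B) hq₀ (by fun_prop)
    (fun q hq => ⟨by linarith [hq.2.1], by linarith [hq.1]⟩) (fun q hq => ?_) ?_
    (integrableOn_const (by simp)) (fun v hv => ?_)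
  · exact ((continuousOn_duhamelIntegrand hG i hq.2.2.2.1).mono
      Ioc_subset_Ioi_self).aestronglyMeasurable measurableSet_Ioc
  · have h : ∀ᶠ q : ℝ × ℝ × ℝ in nhds q₀, q.2.1 < q₀.2.1 + 1 :=
      (by fun_prop : Continuous fun q : ℝ × ℝ × ℝ => q.2.1).continuousAt.eventually_lt_const
        (by simp)
    filter_upwards [self_mem_nhdsWithin, nhdsWithin_le_nhds h] with q hq hqs v hv
    exact hB _ _ _ v hq.2.2.2.1 hv.1 hv.2 hq.2.2.1 hqs.le
  · refine ContinuousWithinAt.mul ?_ ?_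
    · have hpos : 0 < q₀.2.2 + v := by linarith [hq₀.2.2.2.1, hv.1]
      exact (ContinuousAt.comp (f := fun q : ℝ × ℝ × ℝ => q.2.2 + v) (x := q₀)
        ((M.continuousOn_f i).continuousAt (Ioi_mem_nhds hpos))
        (by fun_prop)).continuousWithinAt
    · exact ((continuous_discountedMean_mix hG i).comp
        (by fun_prop : Continuous fun q : ℝ × ℝ × ℝ => (q.1 + v, v, q.2.1))).continuousWithinAt

/-- The two bounds serve the constant and the linear part in `abs_discountedMean_le`. Summing over
regimes replaces a maximum, and the added one makes `B` positive in all cases. -/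
lemma exists_rate_bound (M : SemiMarkovMarket k) (T : ℝ) : ∃ B, 0 < B ∧ ∀ i y v, 0 < y → 0 ≤ v →
    v ≤ T → |M.f i y| * Real.exp (-M.r i * v) ≤ B ∧ |M.f i y| ≤ B := by
  choose D hD using M.f_bounded
  refine ⟨1 + ∑ i, |D i| * Real.exp (|M.r i| * |T|),
    add_pos_of_pos_of_nonneg one_pos (Finset.sum_nonneg fun i _ => by positivity),
    fun i y v hy hv hvT => ?_⟩
  have h1 : |D i| * Real.exp (|M.r i| * |T|) ≤ ∑ i, |D i| * Real.exp (|M.r i| * |T|) :=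
    Finset.single_le_sum (f := fun i => |D i| * Real.exp (|M.r i| * |T|))
      (fun i _ => by positivity) (Finset.mem_univ i)
  have h2 := (hD i y hy).trans (le_abs_self _)
  have h3 : -M.r i * v ≤ |M.r i| * |T| := by
    simpa using mul_le_abs_mul (-M.r i) hv (hvT.trans (le_abs_self T))
  have h4 : |D i| ≤ |D i| * Real.exp (|M.r i| * |T|) :=
    le_mul_of_one_le_right (abs_nonneg _) (Real.one_le_exp (by positivity))
  have h5 : |M.f i y| * Real.exp (-M.r i * v) ≤ |D i| * Real.exp (|M.r i| * |T|) := by gcongr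
  constructor <;> linarith

/-- The Duhamel term contracts the weighted norms with a large exponential rate. -/
lemma abs_duhamel_le {B : ℝ} (hB : 0 < B) (hfB : ∀ i y v, 0 < y → 0 ≤ v →
    v ≤ T → |M.f i y| * Real.exp (-M.r i * v) ≤ B ∧ |M.f i y| ≤ B) {N : ℝ} (hN : 0 ≤ N)
    {t s : ℝ} (ht : 0 ≤ t) (htT : t ≤ T) (hs : 0 ≤ s) (i : Fin k) (hG : ∀ j u x, 0 ≤ u → u ≤ T →
      0 ≤ x → |G j u x| ≤ N * ((1 + x) * Real.exp (2 * B * (T - u)))) :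
    |∫ v in (0 : ℝ)..(T - t), M.f i (0 + v) *
      discountedMean (M.r i) (M.σ i) (M.mix G i (t + v)) v s| ≤
      N / 2 * ((1 + s) * Real.exp (2 * B * (T - t))) := by
  have hT : 0 ≤ T - t := sub_nonneg.2 htT
  -- Multiplied by the bound `B` on the density, this yields the contraction factor one half.
  have hE : ∫ v in (0 : ℝ)..(T - t), Real.exp (-(2 * B) * v) ≤ 1 / (2 * B) := by
    have hd : ∀ v ∈ uIcc 0 (T - t), HasDerivAt (fun v => -Real.exp (-(2 * B) * v) / (2 * B))
        (Real.exp (-(2 * B) * v)) v := fun v _ => by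
      have := (((hasDerivAt_id v).const_mul (-(2 * B))).exp.neg).div_const (2 * B)
      refine HasDerivAt.congr_deriv this ?_
      simp only [id]
      field_simp
    rw [intervalIntegral.integral_eq_sub_of_hasDerivAt hd
      (Continuous.intervalIntegrable (by fun_prop) _ _)]
    have : 0 < Real.exp (-(2 * B) * (T - t)) / (2 * B) := by positivity
    simp only [mul_zero, Real.exp_zero, neg_div]
    linarith
  have hb : ∀ v ∈ Ioc 0 (T - t), ‖M.f i (0 + v) *
      discountedMean (M.r i) (M.σ i) (M.mix G i (t + v)) v s‖ ≤
      (N * B * ((1 + s) * Real.exp (2 * B * (T - t)))) * Real.exp (-(2 * B) * v) := fun v hv => by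
    obtain ⟨h1, h2⟩ := hfB i (0 + v) v (by linarith [hv.1]) hv.1.le (by linarith [hv.2])
    set E := Real.exp (2 * B * (T - (t + v))) with hEdef
    have hE0 : 0 < E := Real.exp_pos _
    have h3 := abs_discountedMean_le (r := M.r i) (σ := M.σ i) (g := M.mix G i (t + v))
      (A := N * E) (B := N * E) (v := v) hs (fun x hx => (abs_mix_le (fun j => hG j (t + v) x
        (by linarith [hv.1]) (by linarith [hv.2]) hx) i).trans_eq (by ring)) hv.1.le
    rw [norm_mul, Real.norm_eq_abs, Real.norm_eq_abs]
    -- The weight at time `t + v` is smaller than that at `t` by an exponential in the delay.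
    have h4 : Real.exp (2 * B * (T - t)) * Real.exp (-(2 * B) * v) = E := by
      rw [← Real.exp_add, hEdef]; ring_nf
    calc _ ≤ |M.f i (0 + v)| * (N * E * Real.exp (-M.r i * v) + N * E * s) := by gcongr
      _ = N * E * (|M.f i (0 + v)| * Real.exp (-M.r i * v) + |M.f i (0 + v)| * s) := by ring
      _ ≤ N * E * (B + B * s) := by gcongr
      _ = _ := by rw [← h4]; ring
  rw [← Real.norm_eq_abs]
  refine (intervalIntegral.norm_integral_le_of_norm_le hT (Filter.Eventually.of_forall hb)
    (Continuous.intervalIntegrable (by fun_prop) _ _)).trans ?_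
  rw [intervalIntegral.integral_const_mul]
  refine (mul_le_mul_of_nonneg_left hE (by positivity)).trans_eq ?_
  field_simp

lemma volterra_zero (t s : ℝ) (i : Fin k) : M.volterra T K G t s i 0 =
    (1 - M.F i (T - t)) * blackScholesCall T K (M.r i) (M.σ i) t s +
    ∫ v in (0 : ℝ)..(T - t),
      M.f i (0 + v) * discountedMean (M.r i) (M.σ i) (M.mix G i (t + v)) v s := by
  rw [volterra, M.F_zero, add_zero, sub_zero, div_one]

/-- The operator is affine: the call term cancels, and the remaining linear part is the Duhamel term
of the difference. -/
lemma abs_volterra_sub_le (hG : HasLinearPayoffs G C) (hG' : HasLinearPayoffs G' C') {B : ℝ}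
    (hB : 0 < B) (hfB : ∀ i y v, 0 < y → 0 ≤ v →
    v ≤ T → |M.f i y| * Real.exp (-M.r i * v) ≤ B ∧ |M.f i y| ≤ B) {N : ℝ} (hN : 0 ≤ N)
    {t s : ℝ} (ht : 0 ≤ t) (htT : t ≤ T) (hs : 0 ≤ s) (i : Fin k) (hGG' : ∀ j u x, 0 ≤ u → u ≤ T →
      0 ≤ x → |G j u x - G' j u x| ≤ N * ((1 + x) * Real.exp (2 * B * (T - u)))) :
    |M.volterra T K G t s i 0 - M.volterra T K G' t s i 0| ≤
      N / 2 * ((1 + s) * Real.exp (2 * B * (T - t))) := by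
  have hT : 0 ≤ T - t := sub_nonneg.2 htT
  rw [volterra_zero, volterra_zero, add_sub_add_left_eq_sub,
    ← intervalIntegral.integral_sub (intervalIntegrable_duhamelIntegrand hG i le_rfl hs hT)
      (intervalIntegrable_duhamelIntegrand hG' i le_rfl hs hT)]
  refine le_of_eq_of_le ?_ (abs_duhamel_le (G := fun j u x => G j u x - G' j u x) hB hfB hN ht htT
    hs i hGG')
  congr 1
  refine intervalIntegral.integral_congr fun v _ => ?_
  rw [← mul_sub, ← discountedMean_sub (continuous_mix_right hG i _) (continuous_mix_right hG' i _)
    (abs_mix_le_linear hG i _) (abs_mix_le_linear hG' i _)]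
  congr 2
  ext x
  simp only [mix, mul_sub, Finset.sum_sub_distrib]

/-- Needed for the operator to act on the weighted space: the call, priced below the stock, has
weighted norm at most one. -/
lemma abs_volterra_zero_le (hK : 0 < K) {B : ℝ} (hB : 0 < B)
    (hfB : ∀ i y v, 0 < y → 0 ≤ v →
    v ≤ T → |M.f i y| * Real.exp (-M.r i * v) ≤ B ∧ |M.f i y| ≤ B) {N : ℝ} (hN : 0 ≤ N)
    {t s : ℝ} (ht : 0 ≤ t) (htT : t ≤ T) (hs : 0 ≤ s) (i : Fin k) (hG : ∀ j u x, 0 ≤ u → u ≤ T →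
      0 ≤ x → |G j u x| ≤ N * ((1 + x) * Real.exp (2 * B * (T - u)))) :
    |M.volterra T K G t s i 0| ≤ (1 + N / 2) * ((1 + s) * Real.exp (2 * B * (T - t))) := by
  have hT : 0 ≤ T - t := sub_nonneg.2 htT
  rw [volterra_zero]
  have h1 := M.one_sub_F_pos i hT
  have h2 : 0 ≤ M.F i (T - t) := cdf_nonneg _ _
  have h3 : |blackScholesCall T K (M.r i) (M.σ i) t s| ≤ s := by
    rw [blackScholesCall_eq]
    simpa using abs_discountedMean_le (r := M.r i) (σ := M.σ i) (A := 0) (B := 1) hs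
      (fun x hx => by simpa [abs_of_nonneg hx] using (isLipschitzPayoff_call hK).abs_le 0 x) hT
  have h4 : 1 ≤ Real.exp (2 * B * (T - t)) := Real.one_le_exp (by positivity)
  have h5 := abs_duhamel_le hB hfB hN ht htT hs i hG
  have h6 : |(1 - M.F i (T - t)) * blackScholesCall T K (M.r i) (M.σ i) t s| ≤
      (1 + s) * Real.exp (2 * B * (T - t)) := by
    rw [abs_mul, abs_of_pos h1]
    calc (1 - M.F i (T - t)) * |blackScholesCall T K (M.r i) (M.σ i) t s| ≤ 1 * s := by
          gcongr
          linarith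
      _ ≤ (1 + s) * 1 := by linarith
      _ ≤ _ := by gcongr
  refine (abs_add_le _ _).trans ((add_le_add h6 h5).trans_eq ?_)
  ring

/-- The Volterra operator preserves 1-Lipschitz prices: the weights `1 - F` and `f` add up to a
probability, and discounted stock prices are martingales. -/
lemma abs_volterra_sub_volterra_le (hK : 0 < K) (hG : HasLinearPayoffs G C)
    (hL : ∀ j, IsLipschitzPayoff (G j)) {t s s' : ℝ} (htT : t ≤ T) (hs : 0 ≤ s) (hs' : 0 ≤ s')
    (i : Fin k) :
    |M.volterra T K G t s i 0 - M.volterra T K G t s' i 0| ≤ |s - s'| := by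
  have hT : 0 ≤ T - t := sub_nonneg.2 htT
  rw [volterra_zero, volterra_zero, add_sub_add_comm, ← mul_sub,
    ← intervalIntegral.integral_sub (intervalIntegrable_duhamelIntegrand hG i le_rfl hs hT)
      (intervalIntegrable_duhamelIntegrand hG i le_rfl hs' hT)]
  have h1 := M.one_sub_F_pos i hT
  have hcall := isLipschitzPayoff_call hK
  have h2 : |(1 - M.F i (T - t)) * (blackScholesCall T K (M.r i) (M.σ i) t s -
      blackScholesCall T K (M.r i) (M.σ i) t s')| ≤ (1 - M.F i (T - t)) * |s - s'| := by
    rw [abs_mul, abs_of_pos h1]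
    exact mul_le_mul_of_nonneg_left (abs_discountedMean_sub_le (hcall.continuous_right 0)
      (hcall.abs_le_one_add 0) (fun x y _ _ => hcall.lipschitz 0 x y) hs hs' hT) h1.le
  have hmix := isLipschitzPayoff_mix (M := M) hL i
  refine (abs_add_le _ _).trans ((add_le_add h2 (?_ : _ ≤ M.F i (T - t) * |s - s'|)).trans_eq
    (by ring))
  -- The remaining weight `F (T - t)` is spread as the mass of `f` over the delays, so that the
  -- integrands can be compared pointwise.
  rw [← Real.norm_eq_abs, ← M.integral_f i hT, ← intervalIntegral.integral_mul_const]
  refine intervalIntegral.norm_integral_le_of_norm_le hT (Filter.Eventually.of_forall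
    fun v hv => ?_) ((M.intervalIntegrable_f i hT).mul_const _)
  have hf := M.f_pos i hv.1
  rw [zero_add, ← mul_sub, norm_mul, Real.norm_of_nonneg hf.le]
  exact mul_le_mul_of_nonneg_left (abs_discountedMean_sub_le (hmix.continuous_right _)
    (hmix.abs_le_one_add _) (fun x y _ _ => hmix.lipschitz _ x y) hs hs' hv.1.le) hf.le

lemma volterra_stock_zero (hK : 0 < K) (hL : ∀ j u, G j u 0 = 0) (t y : ℝ) (i : Fin k) :
    M.volterra T K G t 0 i y = 0 := by
  have h1 : blackScholesCall T K (M.r i) (M.σ i) t 0 = 0 :=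
    discountedMean_zero_right (g := fun x => max (x - K) 0) (max_eq_right (by linarith)) _ _ _
  have h2 : ∀ v, discountedMean (M.r i) (M.σ i) (M.mix G i (t + v)) v 0 = 0 := fun v =>
    discountedMean_zero_right (by simp [mix, hL]) _ _ _
  simp [volterra, h1, h2]

end SemiMarkovMarket

/-! ### The closed Volterra equation: existence and uniqueness. -/

/-- The projection of the real line to the time interval `[0, T]`. -/
noncomputable def clampTime (T t : ℝ) : ℝ := max 0 (min t T)

lemma clampTime_nonneg (T t : ℝ) : 0 ≤ clampTime T t := le_max_left _ _

lemma clampTime_le {T : ℝ} (hT : 0 ≤ T) (t : ℝ) : clampTime T t ≤ T :=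
  max_le hT (min_le_right _ _)

lemma clampTime_of_mem {T t : ℝ} (ht : 0 ≤ t) (htT : t ≤ T) : clampTime T t = t := by
  rw [clampTime, min_eq_left htT, max_eq_right ht]

lemma continuous_clampTime (T : ℝ) : Continuous (clampTime T) := by
  unfold clampTime; fun_prop

/-- The family of prices encoded by a bounded function, after multiplication by an exponential
weight in time and a linear weight in the stock price. -/
noncomputable def weightedPrice {k : ℕ} (T B : ℝ)
    (u : BoundedContinuousFunction (Fin k × ℝ × ℝ) ℝ) (j : Fin k) (t s : ℝ) : ℝ :=
  (1 + max s 0) * Real.exp (2 * B * (T - clampTime T t)) * u (j, t, s)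

lemma weight_pos (B T t s : ℝ) : 0 < (1 + max s 0) * Real.exp (2 * B * (T - t)) := by
  have := le_max_right s 0
  positivity

lemma closedDomain_clamp {T : ℝ} (hT : 0 ≤ T) (t s : ℝ) :
    (clampTime T t, max s 0, (0 : ℝ)) ∈ closedDomain T :=
  ⟨clampTime_nonneg T t, clampTime_le hT t, le_max_right _ _, le_rfl, clampTime_nonneg T t⟩

section WeightedPrice

variable {k : ℕ} {T B : ℝ} (u : BoundedContinuousFunction (Fin k × ℝ × ℝ) ℝ)

lemma continuous_weightedPrice (j : Fin k) :
    Continuous fun q : ℝ × ℝ => weightedPrice T B u j q.1 q.2 := by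
  unfold weightedPrice
  have := continuous_clampTime T
  have hu := u.continuous
  fun_prop

lemma abs_weightedPrice_le (j : Fin k) (t s : ℝ) : |weightedPrice T B u j t s| ≤
    ‖u‖ * ((1 + max s 0) * Real.exp (2 * B * (T - clampTime T t))) := by
  rw [weightedPrice, abs_mul, abs_of_pos (weight_pos _ _ _ _), mul_comm]
  exact mul_le_mul_of_nonneg_right (u.norm_coe_le_norm _) (weight_pos _ _ _ _).le

lemma hasLinearPayoffs_weightedPrice (hB : 0 < B) :
    HasLinearPayoffs (weightedPrice T B u) (‖u‖ * Real.exp (2 * B * T)) where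
  continuous := continuous_weightedPrice u
  bound j t s := by
    refine (abs_weightedPrice_le u j t s).trans ?_
    have h1 : max s 0 ≤ |s| := max_le (le_abs_self s) (abs_nonneg s)
    have h2 : 0 ≤ max s 0 := le_max_right _ _
    have h3 : T - clampTime T t ≤ T := by linarith [clampTime_nonneg T t]
    calc _ ≤ ‖u‖ * ((1 + |s|) * Real.exp (2 * B * T)) := by gcongr
      _ = _ := by ring

lemma abs_weightedPrice_sub_le (u' : BoundedContinuousFunction (Fin k × ℝ × ℝ) ℝ) (j : Fin k)
    (t s : ℝ) : |weightedPrice T B u j t s - weightedPrice T B u' j t s| ≤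
      dist u u' * ((1 + max s 0) * Real.exp (2 * B * (T - clampTime T t))) := by
  rw [weightedPrice, weightedPrice, ← mul_sub, abs_mul, abs_of_pos (weight_pos _ _ _ _), mul_comm]
  have h := u.dist_coe_le_dist (g := u') (j, t, s)
  rw [Real.dist_eq] at h
  exact mul_le_mul_of_nonneg_right h (weight_pos _ _ _ _).le

end WeightedPrice

namespace SemiMarkovMarket

variable {k : ℕ}

/-- Existence for the Volterra equation at the jump times, within the prices that are 1-Lipschitz
in the stock price. -/
theorem exists_volterra_fixedPoint (M : SemiMarkovMarket k) {T K : ℝ} (hT : 0 ≤ T) (hK : 0 < K) :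
    ∃ G : Fin k → ℝ → ℝ → ℝ, (∀ j, IsLipschitzPayoff (G j)) ∧
      ∀ i t s, G i t s = M.volterra T K G (clampTime T t) (max s 0) i 0 := by
  obtain ⟨B, hB, hfB⟩ := M.exists_rate_bound T
  let X := BoundedContinuousFunction (Fin k × ℝ × ℝ) ℝ
  have hlin : ∀ u : X, HasLinearPayoffs (weightedPrice T B u) (‖u‖ * Real.exp (2 * B * T)) :=
    fun u => hasLinearPayoffs_weightedPrice u hB
  let W : ℝ → ℝ → ℝ := fun t s => (1 + max s 0) * Real.exp (2 * B * (T - clampTime T t))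
  have hW : ∀ t s, 0 < W t s := fun t s => weight_pos _ _ _ _
  have hdom : ∀ (u : X) j t s, 0 ≤ t → t ≤ T → 0 ≤ s →
      |weightedPrice T B u j t s| ≤ ‖u‖ * ((1 + s) * Real.exp (2 * B * (T - t))) :=
    fun u j t s ht htT hs => by
      have := abs_weightedPrice_le (T := T) (B := B) u j t s
      rwa [clampTime_of_mem ht htT, max_eq_left hs] at this
  -- The operator in weighted coordinates, so that the weighted norm becomes the sup norm of a
  -- complete space. Clamping `t` and `s` extends functions from the strip to the plane.
  let Ψ : X → X := fun u => BoundedContinuousFunction.ofNormedAddCommGroup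
    (fun q : Fin k × ℝ × ℝ =>
      M.volterra T K (weightedPrice T B u) (clampTime T q.2.1) (max q.2.2 0) q.1 0 / W q.2.1 q.2.2)
    (by
      rw [continuous_prod_of_discrete_left]
      intro i
      have h := (continuousOn_volterra (M := M) (T := T) hK (hlin u) i).comp_continuous
        (f := fun q : ℝ × ℝ => (clampTime T q.1, max q.2 0, (0 : ℝ)))
        (by have := continuous_clampTime T; fun_prop) fun q => closedDomain_clamp hT q.1 q.2
      refine h.div ?_ fun q => (hW _ _).ne'
      have := continuous_clampTime T
      fun_prop)
    (1 + ‖u‖ / 2)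
    (fun q => by
      rw [norm_div, Real.norm_of_nonneg (hW _ _).le, div_le_iff₀ (hW _ _)]
      exact abs_volterra_zero_le hK hB hfB (norm_nonneg u) (clampTime_nonneg _ _)
        (clampTime_le hT _) (le_max_right _ _) q.1 (hdom u))
  have hΨ : ∀ u i t s, weightedPrice T B (Ψ u) i t s =
      M.volterra T K (weightedPrice T B u) (clampTime T t) (max s 0) i 0 := fun u i t s =>
    mul_div_cancel₀ _ (hW t s).ne'
  have hcontr : ContractingWith (1 / 2) Ψ := by
    refine ⟨by rw [div_lt_iff₀] <;> norm_num, LipschitzWith.of_dist_le_mul fun u u' => ?_⟩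
    rw [BoundedContinuousFunction.dist_le (by positivity)]
    rintro ⟨i, t, s⟩
    have h := abs_volterra_sub_le (M := M) (T := T) (K := K) (hlin u) (hlin u') hB hfB
      (N := dist u u') dist_nonneg (clampTime_nonneg T t) (clampTime_le hT t) (le_max_right s 0) i
      (fun j t s ht htT hs => by
        have := abs_weightedPrice_sub_le (T := T) (B := B) u u' j t s
        rwa [clampTime_of_mem ht htT, max_eq_left hs] at this)
    change |_ / W t s - _ / W t s| ≤ _
    rw [← sub_div, abs_div, abs_of_pos (hW t s), div_le_iff₀ (hW t s)]
    refine h.trans_eq ?_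
    simp only [W]
    push_cast
    ring
  -- The weighted norm does not see the Lipschitz constant. The property is therefore carried along
  -- the iterates from zero and passed to the fixed point by pointwise limits.
  have hiter : ∀ n j, IsLipschitzPayoff (weightedPrice T B (Ψ^[n] 0) j) := by
    intro n
    induction n with
    | zero =>
      intro j
      refine ⟨continuous_weightedPrice _ j, fun u x y => ?_, fun u => ?_⟩ <;>
        simp [weightedPrice]
    | succ n ih =>
      intro j
      rw [Function.iterate_succ_apply']
      refine ⟨continuous_weightedPrice _ j, fun u x y => ?_, fun u => ?_⟩
      · rw [hΨ, hΨ]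
        refine (abs_volterra_sub_volterra_le hK (hlin _) ih (clampTime_le hT u)
          (le_max_right _ _) (le_max_right _ _) j).trans ?_
        exact abs_max_sub_max_le_abs x y 0
      · rw [hΨ, max_self]
        exact volterra_stock_zero hK (fun j u => (ih j).zero u) _ _ _
  set u := hcontr.fixedPoint Ψ
  have hu : Ψ u = u := hcontr.fixedPoint_isFixedPt
  have hlim : ∀ j t s, Filter.Tendsto (fun n => weightedPrice T B (Ψ^[n] 0) j t s) Filter.atTop
      (nhds (weightedPrice T B u j t s)) := fun j t s => by
    have h := ((BoundedContinuousFunction.lipschitz_eval_const (j, t, s)).continuous.tendsto u).comp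
      (hcontr.tendsto_iterate_fixedPoint (0 : X))
    exact h.const_mul _
  refine ⟨weightedPrice T B u, fun j => ⟨continuous_weightedPrice u j, fun t x y => ?_,
    fun t => ?_⟩, fun i t s => ?_⟩
  · exact le_of_tendsto ((hlim j t x).sub (hlim j t y)).abs
      (Filter.Eventually.of_forall fun n => (hiter n j).lipschitz t x y)
  · exact tendsto_nhds_unique (hlim j t 0) (by simp [(hiter _ j).zero])
  · conv_lhs => rw [← hu]
    exact hΨ u i t s

/-- Uniqueness for the Volterra equation at the jump times. -/
theorem volterra_fixedPoint_unique (M : SemiMarkovMarket k) {T K C C' : ℝ}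
    {G G' : Fin k → ℝ → ℝ → ℝ} (hG : HasLinearPayoffs G C) (hG' : HasLinearPayoffs G' C')
    (h : ∀ i t s, 0 ≤ t → t ≤ T → 0 ≤ s → G i t s = M.volterra T K G t s i 0)
    (h' : ∀ i t s, 0 ≤ t → t ≤ T → 0 ≤ s → G' i t s = M.volterra T K G' t s i 0)
    (i : Fin k) {t s : ℝ} (ht : 0 ≤ t) (htT : t ≤ T) (hs : 0 ≤ s) : G i t s = G' i t s := by
  obtain ⟨B, hB, hfB⟩ := M.exists_rate_bound T
  have hC : 0 ≤ C := by simpa using (abs_nonneg _).trans (hG.bound i 0 0)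
  have hC' : 0 ≤ C' := by simpa using (abs_nonneg _).trans (hG'.bound i 0 0)
  -- The growth bounds start the induction, and each use of the two equations halves the estimate.
  have key : ∀ n : ℕ, ∀ j t s, 0 ≤ t → t ≤ T → 0 ≤ s → |G j t s - G' j t s| ≤
      (C + C') * (1 / 2) ^ n * ((1 + s) * Real.exp (2 * B * (T - t))) := by
    intro n
    induction n with
    | zero =>
      intro j t s ht htT hs
      have h1 := hG.bound j t s
      have h2 := hG'.bound j t s
      rw [abs_of_nonneg hs] at h1 h2
      have h3 : 1 ≤ Real.exp (2 * B * (T - t)) :=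
        Real.one_le_exp (mul_nonneg (by positivity) (sub_nonneg.2 htT))
      calc |G j t s - G' j t s| ≤ |G j t s| + |G' j t s| := abs_sub _ _
        _ ≤ (C + C') * (1 / 2) ^ 0 * ((1 + s) * 1) := by linarith
        _ ≤ _ := by gcongr
    | succ n ih =>
      intro j t s ht htT hs
      rw [h j t s ht htT hs, h' j t s ht htT hs]
      refine (abs_volterra_sub_le hG hG' hB hfB (by positivity) ht htT hs j ih).trans_eq ?_
      rw [pow_succ]
      ring
  have hlim : Filter.Tendsto (fun n : ℕ =>
      (C + C') * (1 / 2 : ℝ) ^ n * ((1 + s) * Real.exp (2 * B * (T - t)))) Filter.atTop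
      (nhds ((C + C') * 0 * ((1 + s) * Real.exp (2 * B * (T - t))))) :=
    ((tendsto_pow_atTop_nhds_zero_of_lt_one (by norm_num) (by norm_num)).const_mul _).mul_const _
  have h0 := ge_of_tendsto hlim (Filter.Eventually.of_forall fun n => key n i t s ht htT hs)
  rw [mul_zero, zero_mul] at h0
  exact sub_eq_zero.1 (abs_nonpos_iff.1 h0)

end SemiMarkovMarket

/-! ### Calculus of Duhamel integrals of singular kernels. -/

/-- A kernel `b u v s`, continuous for `v, s > 0`, whose singularity at `v = 0` is integrable,
locally uniformly in `s > 0`. -/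
structure IsSingularKernel (T : ℝ) (b : ℝ → ℝ → ℝ → ℝ) : Prop where
  continuousOn : ContinuousOn (fun q : ℝ × ℝ × ℝ => b q.1 q.2.1 q.2.2) {q | 0 < q.2.1 ∧ 0 < q.2.2}
  bound : ∀ p q, 0 < p → ∃ C, 0 ≤ C ∧ ∀ u v s, 0 < v → v ≤ T → p ≤ s → s ≤ q →
    |b u v s| ≤ C / Real.sqrt v

/-- The Duhamel integral of a kernel against a density. -/
noncomputable def duhamel (T : ℝ) (a : ℝ → ℝ) (b : ℝ → ℝ → ℝ → ℝ) (t s y : ℝ) : ℝ :=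
  ∫ v in (0 : ℝ)..(T - t), a (y + v) * b (t + v) v s

namespace IsSingularKernel

variable {T : ℝ} {a a' : ℝ → ℝ} {b b' : ℝ → ℝ → ℝ → ℝ}

lemma of_bounded (hc : ContinuousOn (fun q : ℝ × ℝ × ℝ => b q.1 q.2.1 q.2.2)
    {q | 0 < q.2.1 ∧ 0 < q.2.2}) (hb : ∀ p q, 0 < p → ∃ C, 0 ≤ C ∧ ∀ u v s, 0 < v → v ≤ T →
      p ≤ s → s ≤ q → |b u v s| ≤ C) : IsSingularKernel T b where
  continuousOn := hc
  bound p q hp := by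
    obtain ⟨C, hC, h⟩ := hb p q hp
    refine ⟨C * Real.sqrt T, by positivity, fun u v s hv hvT hps hsq => ?_⟩
    rw [le_div_iff₀ (Real.sqrt_pos.2 hv)]
    exact mul_le_mul (h u v s hv hvT hps hsq) (Real.sqrt_le_sqrt hvT) (Real.sqrt_nonneg _) hC

lemma add (hb : IsSingularKernel T b) (hb' : IsSingularKernel T b') :
    IsSingularKernel T fun u v s => b u v s + b' u v s where
  continuousOn := hb.continuousOn.add hb'.continuousOn
  bound p q hp := by
    obtain ⟨C, hC, h⟩ := hb.bound p q hp
    obtain ⟨C', hC', h'⟩ := hb'.bound p q hp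
    refine ⟨C + C', by positivity, fun u v s hv hvT hps hsq => ?_⟩
    rw [add_div]
    exact (abs_add_le _ _).trans (add_le_add (h u v s hv hvT hps hsq) (h' u v s hv hvT hps hsq))

lemma coeff_mul (hb : IsSingularKernel T b) {c : ℝ → ℝ} (hc : Continuous c) :
    IsSingularKernel T fun u v s => c s * b u v s where
  continuousOn := (hc.comp (by fun_prop :
    Continuous fun q : ℝ × ℝ × ℝ => q.2.2)).continuousOn.mul hb.continuousOn
  bound p q hp := by
    obtain ⟨C, hC, h⟩ := hb.bound p q hp
    obtain ⟨D, hD⟩ := (isCompact_Icc (a := p) (b := q)).exists_bound_of_continuousOn hc.continuousOn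
    refine ⟨|D| * C, by positivity, fun u v s hv hvT hps hsq => ?_⟩
    rw [abs_mul, mul_div_assoc]
    exact mul_le_mul ((hD s ⟨hps, hsq⟩).trans (le_abs_self D)) (h u v s hv hvT hps hsq)
      (abs_nonneg _) (abs_nonneg _)

/-- Keeping the age above `y₁ > 0` confines the argument of `a` to a compact interval. This matters
for `a = f'`, which may be unbounded near zero. -/
lemma exists_bound_mul (hb : IsSingularKernel T b) (ha : ContinuousOn a (Ioi 0)) {p q y₁ y₂ : ℝ}
    (hp : 0 < p) (hy : 0 < y₁) : ∃ C, ∀ u v s y, 0 < v → v ≤ T → p ≤ s → s ≤ q → y₁ ≤ y →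
      y ≤ y₂ → |a (y + v) * b u v s| ≤ C / Real.sqrt v := by
  obtain ⟨C, hC, h⟩ := hb.bound p q hp
  obtain ⟨D, hD⟩ := (isCompact_Icc (a := y₁) (b := y₂ + T)).exists_bound_of_continuousOn
    (ha.mono fun z hz => hy.trans_le hz.1)
  refine ⟨|D| * C, fun u v s y hv hvT hps hsq hy1 hy2 => ?_⟩
  rw [abs_mul, mul_div_assoc]
  exact mul_le_mul ((hD (y + v) ⟨by linarith, by linarith⟩).trans (le_abs_self D))
    (h u v s hv hvT hps hsq) (abs_nonneg _) (abs_nonneg _)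

lemma continuousOn_time (hb : IsSingularKernel T b) (ha : ContinuousOn a (Ioi 0)) {t s y : ℝ}
    (hs : 0 < s) (hy : 0 < y) :
    ContinuousOn (fun v => a (y + v) * b (t + v) v s) (Ioi 0) := by
  refine ContinuousOn.mul ?_ ?_
  · exact ha.comp (by fun_prop) fun v (hv : 0 < v) => add_pos hy hv
  · exact hb.continuousOn.comp (by fun_prop : Continuous fun v : ℝ => (t + v, v, s)).continuousOn
      fun v hv => ⟨hv, hs⟩

lemma intervalIntegrable (hb : IsSingularKernel T b) (ha : ContinuousOn a (Ioi 0)) {t s y : ℝ}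
    (ht : 0 ≤ t) (htT : t ≤ T) (hs : 0 < s) (hy : 0 < y) :
    IntervalIntegrable (fun v => a (y + v) * b (t + v) v s) volume 0 (T - t) := by
  obtain ⟨C, hC⟩ := hb.exists_bound_mul ha (q := s) (y₂ := y) hs hy
  exact intervalIntegrable_of_le_div_sqrt (sub_nonneg.2 htT) (hb.continuousOn_time ha hs hy)
    fun v hv hvt => hC _ _ _ _ hv (by linarith) le_rfl le_rfl le_rfl le_rfl

lemma continuousOn_duhamel (hb : IsSingularKernel T b) (ha : ContinuousOn a (Ioi 0)) :
    ContinuousOn (fun q : ℝ × ℝ × ℝ => duhamel T a b q.1 q.2.1 q.2.2) (openDomain T) := by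
  rintro ⟨t, s, y⟩ hq
  obtain ⟨ht, htT, hs, hy, hyt⟩ := id hq
  obtain ⟨C, hC⟩ := hb.exists_bound_mul ha (q := 2 * s) (y₂ := 2 * y) (half_pos hs) (half_pos hy)
  have hnear : ∀ᶠ q : ℝ × ℝ × ℝ in nhds (t, s, y),
      q.2.1 ∈ Icc (s / 2) (2 * s) ∧ q.2.2 ∈ Icc (y / 2) (2 * y) :=
    ((by fun_prop : Continuous fun q : ℝ × ℝ × ℝ => q.2.1).continuousAt.eventually_mem
      (Icc_mem_nhds (half_lt_self hs) (by simp; linarith))).and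
    ((by fun_prop : Continuous fun q : ℝ × ℝ × ℝ => q.2.2).continuousAt.eventually_mem
      (Icc_mem_nhds (half_lt_self hy) (by simp; linarith)))
  refine continuousWithinAt_integral_of_dominated (V := T) (bound := fun v => C / Real.sqrt v) hq
    (by fun_prop) (fun q hq => ⟨by linarith [hq.2.1], by linarith [hq.1]⟩) (fun q hq => ?_) ?_
    (integrableOn_div_sqrt C T) (fun v hv => ?_)
  · exact ((hb.continuousOn_time ha hq.2.2.1 hq.2.2.2.1).mono
      Ioc_subset_Ioi_self).aestronglyMeasurable measurableSet_Ioc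
  · filter_upwards [nhdsWithin_le_nhds hnear] with q hq v hv
    exact hC _ v _ _ hv.1 hv.2 hq.1.1 hq.1.2 hq.2.1 hq.2.2
  · refine ContinuousAt.continuousWithinAt (ContinuousAt.mul ?_ ?_)
    · exact ContinuousAt.comp (f := fun q : ℝ × ℝ × ℝ => q.2.2 + v) (x := (t, s, y))
        (ha.continuousAt (Ioi_mem_nhds (add_pos hy hv.1))) (by fun_prop)
    · have hopen : IsOpen {q : ℝ × ℝ × ℝ | 0 < q.2.1 ∧ 0 < q.2.2} :=
        (isOpen_lt continuous_const (by fun_prop : Continuous fun q : ℝ × ℝ × ℝ => q.2.1)).inter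
          (isOpen_lt continuous_const (by fun_prop : Continuous fun q : ℝ × ℝ × ℝ => q.2.2))
      exact ContinuousAt.comp (f := fun q : ℝ × ℝ × ℝ => (q.1 + v, v, q.2.1)) (x := (t, s, y))
        (hb.continuousOn.continuousAt (hopen.mem_nhds ⟨hv.1, hs⟩)) (by fun_prop)

lemma hasDerivAt_duhamel_stock (hb : IsSingularKernel T b) (hb' : IsSingularKernel T b')
    (hd : ∀ u v s, 0 < v → 0 < s → HasDerivAt (fun s => b u v s) (b' u v s) s)
    (ha : ContinuousOn a (Ioi 0)) {t s y : ℝ} (ht : 0 ≤ t) (htT : t ≤ T) (hs : 0 < s)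
    (hy : 0 < y) : HasDerivAt (fun s => duhamel T a b t s y) (duhamel T a b' t s y) s := by
  have hT : 0 ≤ T - t := sub_nonneg.2 htT
  obtain ⟨C, hC⟩ := hb'.exists_bound_mul ha (q := 2 * s) (y₂ := y) (half_pos hs) hy
  have hmeas : ∀ {b : ℝ → ℝ → ℝ → ℝ}, IsSingularKernel T b → ∀ {s}, 0 < s → AEStronglyMeasurable
      (fun v => a (y + v) * b (t + v) v s) (volume.restrict (uIoc 0 (T - t))) := fun hb s hs => by
    rw [uIoc_of_le hT]
    exact ((hb.continuousOn_time ha hs hy).mono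
      Ioc_subset_Ioi_self).aestronglyMeasurable measurableSet_Ioc
  refine (intervalIntegral.hasDerivAt_integral_of_dominated_loc_of_deriv_le
    (F := fun s v => a (y + v) * b (t + v) v s) (F' := fun s v => a (y + v) * b' (t + v) v s)
    (bound := fun v => C / Real.sqrt v)
    (Icc_mem_nhds (half_lt_self hs) (by linarith : s < 2 * s)) ?_
    (hb.intervalIntegrable ha ht htT hs hy) (hmeas hb' hs) ?_ ?_ ?_).2
  · filter_upwards [Ioi_mem_nhds hs] with s' hs'
    exact hmeas hb hs'
  · refine Filter.Eventually.of_forall fun v hv s' hs' => ?_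
    rw [uIoc_of_le hT] at hv
    exact hC _ v s' y hv.1 (by linarith [hv.2]) hs'.1 hs'.2 le_rfl le_rfl
  · rw [intervalIntegrable_iff_integrableOn_Ioc_of_le hT]
    exact integrableOn_div_sqrt C _
  · refine Filter.Eventually.of_forall fun v hv s' hs' => ?_
    rw [uIoc_of_le hT] at hv
    exact (hd _ v s' hv.1 ((half_pos hs).trans_le hs'.1)).const_mul _

lemma hasDerivAt_duhamel_age (hb : IsSingularKernel T b) (ha : ContinuousOn a (Ioi 0))
    (ha' : ContinuousOn a' (Ioi 0)) (hd : ∀ y, 0 < y → HasDerivAt a (a' y) y) {t s y : ℝ}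
    (ht : 0 ≤ t) (htT : t ≤ T) (hs : 0 < s) (hy : 0 < y) :
    HasDerivAt (fun y => duhamel T a b t s y) (duhamel T a' b t s y) y := by
  have hT : 0 ≤ T - t := sub_nonneg.2 htT
  obtain ⟨C, hC⟩ := hb.exists_bound_mul ha' (q := s) (y₂ := 2 * y) hs (half_pos hy)
  have hmeas : ∀ {a : ℝ → ℝ}, ContinuousOn a (Ioi 0) → ∀ {y}, 0 < y → AEStronglyMeasurable
      (fun v => a (y + v) * b (t + v) v s) (volume.restrict (uIoc 0 (T - t))) := fun ha y hy => by
    rw [uIoc_of_le hT]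
    exact ((hb.continuousOn_time ha hs hy).mono
      Ioc_subset_Ioi_self).aestronglyMeasurable measurableSet_Ioc
  refine (intervalIntegral.hasDerivAt_integral_of_dominated_loc_of_deriv_le
    (F := fun y v => a (y + v) * b (t + v) v s) (F' := fun y v => a' (y + v) * b (t + v) v s)
    (bound := fun v => C / Real.sqrt v)
    (Icc_mem_nhds (half_lt_self hy) (by linarith : y < 2 * y)) ?_
    (hb.intervalIntegrable ha ht htT hs hy) (hmeas ha' hy) ?_ ?_ ?_).2
  · filter_upwards [Ioi_mem_nhds hy] with y' hy'
    exact hmeas ha hy'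
  · refine Filter.Eventually.of_forall fun v hv y' hy' => ?_
    rw [uIoc_of_le hT] at hv
    exact hC _ v s y' hv.1 (by linarith [hv.2]) le_rfl le_rfl hy'.1 hy'.2
  · rw [intervalIntegrable_iff_integrableOn_Ioc_of_le hT]
    exact integrableOn_div_sqrt C _
  · refine Filter.Eventually.of_forall fun v hv y' hy' => ?_
    rw [uIoc_of_le hT] at hv
    have hpos : 0 < y' + v := add_pos ((half_pos hy).trans_le hy'.1) hv.1
    exact ((hd _ hpos).comp_add_const y' v).mul_const _

/-- Apply `hasDerivAt_duhamel` with `s` and `y` frozen. The delay derivative falls on both the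
density and the kernel, which gives the two integrals besides the value at zero delay. -/
lemma hasDerivAt_duhamel_time (hb : IsSingularKernel T b) (hb' : IsSingularKernel T b')
    (hbc : Continuous fun q : ℝ × ℝ × ℝ => b q.1 q.2.1 q.2.2)
    (hdb : ∀ u v s, 0 < v → 0 < s → HasDerivAt (fun v => b u v s) (b' u v s) v)
    (ha : ContinuousOn a (Ioi 0)) (ha' : ContinuousOn a' (Ioi 0))
    (hda : ∀ y, 0 < y → HasDerivAt a (a' y) y) {t s y : ℝ}
    (ht : 0 < t) (htT : t < T) (hs : 0 < s) (hy : 0 < y) :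
    HasDerivAt (fun t => duhamel T a b t s y)
      (-(a y * b t 0 s + (duhamel T a' b t s y + duhamel T a b' t s y))) t := by
  obtain ⟨C₁, hC₁⟩ := hb.exists_bound_mul ha' (q := s) (y₂ := y) hs hy
  obtain ⟨C₂, hC₂⟩ := hb'.exists_bound_mul ha (q := s) (y₂ := y) hs hy
  have hq : ∀ {a : ℝ → ℝ} {b : ℝ → ℝ → ℝ → ℝ}, IsSingularKernel T b → ContinuousOn a (Ioi 0) →
      ContinuousOn (fun q : ℝ × ℝ => a (y + q.2) * b q.1 q.2 s) {q | 0 < q.2} := fun hb ha =>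
    (ha.comp (by fun_prop : Continuous fun q : ℝ × ℝ => y + q.2).continuousOn
      fun q (hq : 0 < q.2) => add_pos hy hq).mul
    (hb.continuousOn.comp (by fun_prop : Continuous fun q : ℝ × ℝ => (q.1, q.2, s)).continuousOn
      fun q hq => ⟨hq, hs⟩)
  have h := hasDerivAt_duhamel (Φ := fun u v => a (y + v) * b u v s)
    (Φ' := fun u v => a' (y + v) * b u v s + a (y + v) * b' u v s) (C := C₁ + C₂) ht htT
    (continuous_const.mul (hbc.comp (by fun_prop : Continuous fun u : ℝ => (u, (0 : ℝ), s))))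
    (fun u => (ha.comp (by fun_prop : Continuous fun v : ℝ => y + v).continuousOn
      fun v (hv : 0 ≤ v) => add_pos_of_pos_of_nonneg hy hv).mul
      (hbc.comp (by fun_prop : Continuous fun v : ℝ => (u, v, s))).continuousOn)
    (fun u v hv => ((hda _ (add_pos hy hv)).comp_const_add y v).mul (hdb u v s hv hs))
    ((hq hb ha').add (hq hb' ha))
    (fun u v hv hvT => by
      rw [add_div]
      exact (abs_add_le _ _).trans (add_le_add (hC₁ u v s y hv hvT le_rfl le_rfl le_rfl le_rfl)
        (hC₂ u v s y hv hvT le_rfl le_rfl le_rfl le_rfl)))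
  refine HasDerivAt.congr_deriv h ?_
  rw [intervalIntegral.integral_add (hb.intervalIntegrable ha' ht.le htT.le hs hy)
    (hb'.intervalIntegrable ha ht.le htT.le hs hy), add_zero]
  rfl

end IsSingularKernel

lemma IsLipschitzPayoff.isSingularKernel_discountedMean {G : ℝ → ℝ → ℝ} (hG : IsLipschitzPayoff G)
    (T r σ : ℝ) : IsSingularKernel T fun u v s => discountedMean r σ (G u) v s := by
  refine .of_bounded (continuous_discountedMean hG.continuous hG.abs_le_one_add r σ).continuousOn
    fun p q hp => ⟨|q|, abs_nonneg q, fun u v s hv _ hps hsq => ?_⟩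
  have hs : 0 ≤ s := hp.le.trans hps
  refine (abs_discountedMean_le (A := 0) (B := 1) hs (fun x hx => ?_) hv.le).trans ?_
  · simpa [abs_of_nonneg hx] using hG.abs_le u x
  · simpa using hsq.trans (le_abs_self q)

lemma duhamel_add {T : ℝ} {a : ℝ → ℝ} {b b' : ℝ → ℝ → ℝ → ℝ} (hb : IsSingularKernel T b)
    (hb' : IsSingularKernel T b') (ha : ContinuousOn a (Ioi 0)) {t s y : ℝ} (ht : 0 ≤ t)
    (htT : t ≤ T) (hs : 0 < s) (hy : 0 < y) :
    duhamel T a (fun u v s => b u v s + b' u v s) t s y =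
      duhamel T a b t s y + duhamel T a b' t s y := by
  simp only [duhamel, mul_add]
  exact intervalIntegral.integral_add (hb.intervalIntegrable ha ht htT hs hy)
    (hb'.intervalIntegrable ha ht htT hs hy)

lemma duhamel_coeff_mul (T : ℝ) (a : ℝ → ℝ) (b : ℝ → ℝ → ℝ → ℝ) (c : ℝ → ℝ) (t s y : ℝ) :
    duhamel T a (fun u v s => c s * b u v s) t s y = c s * duhamel T a b t s y := by
  simp only [duhamel, mul_left_comm _ (c s)]
  exact intervalIntegral.integral_const_mul _ _

/-! ### Regularity of the solution and the differential equation. -/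

lemma IsC121.of_hasDerivAt {k : ℕ} {T : ℝ} {φ : ℝ → ℝ → Fin k → ℝ → ℝ}
    {φt φs φss φy : Fin k → ℝ → ℝ → ℝ → ℝ}
    (hφ : ∀ i, ContinuousOn (fun q : ℝ × ℝ × ℝ => φ q.1 q.2.1 i q.2.2) (openDomain T))
    (ht : ∀ i t s y, (t, s, y) ∈ openDomain T →
      HasDerivAt (fun t' => φ t' s i y) (φt i t s y) t)
    (hs : ∀ i t s y, (t, s, y) ∈ openDomain T →
      HasDerivAt (fun s' => φ t s' i y) (φs i t s y) s)
    (hss : ∀ i t s y, (t, s, y) ∈ openDomain T →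
      HasDerivAt (deriv fun s' => φ t s' i y) (φss i t s y) s)
    (hy : ∀ i t s y, (t, s, y) ∈ openDomain T →
      HasDerivAt (fun y' => φ t s i y') (φy i t s y) y)
    (htc : ∀ i, ContinuousOn (fun q : ℝ × ℝ × ℝ => φt i q.1 q.2.1 q.2.2) (openDomain T))
    (hsc : ∀ i, ContinuousOn (fun q : ℝ × ℝ × ℝ => φs i q.1 q.2.1 q.2.2) (openDomain T))
    (hssc : ∀ i, ContinuousOn (fun q : ℝ × ℝ × ℝ => φss i q.1 q.2.1 q.2.2) (openDomain T))
    (hyc : ∀ i, ContinuousOn (fun q : ℝ × ℝ × ℝ => φy i q.1 q.2.1 q.2.2) (openDomain T)) :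
    IsC121 T φ where
  differentiable_t t s i y h := (ht i t s y h).differentiableAt
  differentiable_s t s i y h := (hs i t s y h).differentiableAt
  differentiable_ss t s i y h := (hss i t s y h).differentiableAt
  differentiable_y t s i y h := (hy i t s y h).differentiableAt
  continuous := hφ
  continuous_t i := (htc i).congr fun q hq => (ht i q.1 q.2.1 q.2.2 hq).deriv
  continuous_s i := (hsc i).congr fun q hq => (hs i q.1 q.2.1 q.2.2 hq).deriv
  continuous_ss i := (hssc i).congr fun q hq => (hss i q.1 q.2.1 q.2.2 hq).deriv
  continuous_y i := (hyc i).congr fun q hq => (hy i q.1 q.2.1 q.2.2 hq).deriv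

lemma openDomain_subset_closedDomain (T : ℝ) : openDomain T ⊆ closedDomain T :=
  fun _ h => ⟨h.1.le, h.2.1.le, h.2.2.1.le, h.2.2.2.1.le, h.2.2.2.2.le⟩

namespace SemiMarkovMarket

variable {k : ℕ}

lemma hasLinearPayoffs_of_isLipschitzPayoff {G : Fin k → ℝ → ℝ → ℝ}
    (hG : ∀ j, IsLipschitzPayoff (G j)) : HasLinearPayoffs G 1 :=
  ⟨fun j => (hG j).continuous, fun j => (hG j).abs_le_one_add⟩

/-- The image of Lipschitz prices under the Volterra operator is smooth on the open domain, and
solves the Black--Scholes equation with a source at the jump times. -/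
theorem exists_deriv_volterra (M : SemiMarkovMarket k) {T K : ℝ} (hK : 0 < K)
    {G : Fin k → ℝ → ℝ → ℝ} (hG : ∀ j, IsLipschitzPayoff (G j)) (i : Fin k) :
    ∃ φt φs φss φy : ℝ → ℝ → ℝ → ℝ,
      (∀ t s y, (t, s, y) ∈ openDomain T →
        HasDerivAt (fun t' => M.volterra T K G t' s i y) (φt t s y) t ∧
        HasDerivAt (fun s' => M.volterra T K G t s' i y) (φs t s y) s ∧
        HasDerivAt (fun s' => φs t s' y) (φss t s y) s ∧
        HasDerivAt (fun y' => M.volterra T K G t s i y') (φy t s y) y ∧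
        φt t s y + φy t s y + M.r i * s * φs t s y + 1 / 2 * M.σ i ^ 2 * s ^ 2 * φss t s y
          + M.f i y / (1 - M.F i y) * (M.mix G i t s - M.volterra T K G t s i y)
          = M.r i * M.volterra T K G t s i y) ∧
      ContinuousOn (fun q : ℝ × ℝ × ℝ => φt q.1 q.2.1 q.2.2) (openDomain T) ∧
      ContinuousOn (fun q : ℝ × ℝ × ℝ => φs q.1 q.2.1 q.2.2) (openDomain T) ∧
      ContinuousOn (fun q : ℝ × ℝ × ℝ => φss q.1 q.2.1 q.2.2) (openDomain T) ∧
      ContinuousOn (fun q : ℝ × ℝ × ℝ => φy q.1 q.2.1 q.2.2) (openDomain T) := by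
  have hmix := isLipschitzPayoff_mix (M := M) hG i
  have hlin := hasLinearPayoffs_of_isLipschitzPayoff hG
  obtain ⟨D₁, D₂, hD₁, hD₂, hDv, hD₁c, hD₂c, hDb⟩ :=
    exists_deriv_discountedMean hmix (M.r i) (M.σ_pos i)
  obtain ⟨C₁, C₂, hC₁, hC₂, hCv, hC₁c, hC₂c, -⟩ :=
    exists_deriv_discountedMean (isLipschitzPayoff_call hK) (M.r i) (M.σ_pos i)
  set r := M.r i
  set σ := M.σ i
  set f := M.f i
  set f' := deriv (M.f i)
  set S : ℝ → ℝ := fun y => 1 - M.F i y with hSdef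
  set E : ℝ → ℝ → ℝ → ℝ := fun u v s => discountedMean r σ (M.mix G i u) v s with hEdef
  -- The Black–Scholes operator applied to `E`, which is also its derivative in the delay.
  set L : ℝ → ℝ → ℝ → ℝ := fun u v s =>
    r * s * D₁ u v s + 1 / 2 * σ ^ 2 * s ^ 2 * D₂ u v s + -r * E u v s with hLdef
  set c : ℝ → ℝ → ℝ := fun τ s => discountedMean r σ (fun x => max (x - K) 0) τ s with hcdef
  have hf : ContinuousOn f (Ioi 0) := M.continuousOn_f i
  have hf' : ContinuousOn f' (Ioi 0) := M.continuousOn_deriv_f i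
  have hff' : ∀ y, 0 < y → HasDerivAt f (f' y) y := fun y hy => M.hasDerivAt_f i hy
  have hS : ∀ y, 0 < y → HasDerivAt S (-f y) y := fun y hy => (M.hasDerivAt_F i hy).const_sub 1
  have hS0 : ∀ y, 0 < y → S y ≠ 0 := fun y hy => (M.one_sub_F_pos i hy.le).ne'
  have hEk : IsSingularKernel T E := hmix.isSingularKernel_discountedMean T r σ
  have hD₁k : IsSingularKernel T D₁ := ⟨hD₁c, fun p q hp => (hDb T p q hp).imp fun C hC =>
    ⟨hC.1, fun u v s h1 h2 h3 h4 => (hC.2 u v s h1 h2 h3 h4).1⟩⟩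
  have hD₂k : IsSingularKernel T D₂ := ⟨hD₂c, fun p q hp => (hDb T p q hp).imp fun C hC =>
    ⟨hC.1, fun u v s h1 h2 h3 h4 => (hC.2 u v s h1 h2 h3 h4).2⟩⟩
  have hA₁ : IsSingularKernel T fun u v s => r * s * D₁ u v s :=
    hD₁k.coeff_mul (c := fun s => r * s) (by fun_prop)
  have hA₂ : IsSingularKernel T fun u v s => 1 / 2 * σ ^ 2 * s ^ 2 * D₂ u v s :=
    hD₂k.coeff_mul (c := fun s => 1 / 2 * σ ^ 2 * s ^ 2) (by fun_prop)
  have hA₀ : IsSingularKernel T fun u v s => -r * E u v s :=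
    hEk.coeff_mul (c := fun _ => -r) (by fun_prop)
  have hLk : IsSingularKernel T L := (hA₁.add hA₂).add hA₀
  have hJL : ∀ t s y, (t, s, y) ∈ openDomain T → duhamel T f L t s y =
      r * s * duhamel T f D₁ t s y + 1 / 2 * σ ^ 2 * s ^ 2 * duhamel T f D₂ t s y +
        -r * duhamel T f E t s y := fun t s y h => by
    rw [hLdef, duhamel_add (hA₁.add hA₂) hA₀ hf h.1.le h.2.1.le h.2.2.1 h.2.2.2.1,
      duhamel_add hA₁ hA₂ hf h.1.le h.2.1.le h.2.2.1 h.2.2.2.1,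
      duhamel_coeff_mul T f D₁ (fun s => r * s),
      duhamel_coeff_mul T f D₂ (fun s => 1 / 2 * σ ^ 2 * s ^ 2),
      duhamel_coeff_mul T f E (fun _ => -r)]
  have hφ : ∀ t s y, M.volterra T K G t s i y =
      (S (T - t + y) * c (T - t) s + duhamel T f E t s y) / S y := fun t s y => rfl
  have hcE : ∀ t s, E t 0 s = M.mix G i t s := fun t s => discountedMean_zero_left _ _ _ _
  refine ⟨fun t s y => (f (T - t + y) * c (T - t) s - S (T - t + y) *
        (r * s * C₁ 0 (T - t) s + 1 / 2 * σ ^ 2 * s ^ 2 * C₂ 0 (T - t) s - r * c (T - t) s) -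
        (f y * M.mix G i t s + (duhamel T f' E t s y + duhamel T f L t s y))) / S y,
    fun t s y => (S (T - t + y) * C₁ 0 (T - t) s + duhamel T f D₁ t s y) / S y,
    fun t s y => (S (T - t + y) * C₂ 0 (T - t) s + duhamel T f D₂ t s y) / S y,
    fun t s y => ((-f (T - t + y) * c (T - t) s + duhamel T f' E t s y) * S y -
      (S (T - t + y) * c (T - t) s + duhamel T f E t s y) * -f y) / S y ^ 2, ?_, ?_⟩
  · intro t s y h
    obtain ⟨ht, htT, hs, hy, hyt⟩ := id h
    have hτ : 0 < T - t := sub_pos.2 htT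
    have hτy : 0 < T - t + y := add_pos hτ hy
    simp only [hφ]
    refine ⟨?_, ?_, ?_, ?_, ?_⟩
    · have d0 : HasDerivAt (fun t => T - t) (-1) t := (hasDerivAt_id t).const_sub T
      have d1 : HasDerivAt (fun t => S (T - t + y)) (-f (T - t + y) * -1) t :=
        HasDerivAt.comp (h₂ := S) t (hS _ hτy) (d0.add_const y)
      have d2 : HasDerivAt (fun t => c (T - t) s) ((r * s * C₁ 0 (T - t) s +
          1 / 2 * σ ^ 2 * s ^ 2 * C₂ 0 (T - t) s - r * c (T - t) s) * -1) t :=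
        (hCv 0 (T - t) s hτ hs).comp t d0
      have d3 := hEk.hasDerivAt_duhamel_time hLk (continuous_discountedMean_mix hlin i)
        (fun u v s hv hs => (hDv u v s hv hs).congr_deriv (by simp only [hLdef, hEdef]; ring))
        hf hf' hff' ht htT hs hy
      refine (((d1.mul d2).add d3).div_const (S y)).congr_deriv ?_
      rw [hcE]
      ring
    · exact (((hC₁ 0 (T - t) s hτ hs).const_mul _).add (hEk.hasDerivAt_duhamel_stock hD₁k hD₁ hf
        ht.le htT.le hs hy)).div_const _
    · exact (((hC₂ 0 (T - t) s hτ hs).const_mul _).add (hD₁k.hasDerivAt_duhamel_stock hD₂k hD₂ hf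
        ht.le htT.le hs hy)).div_const _
    · exact ((((hS _ hτy).comp_const_add (T - t) y).mul_const _).add
        (hEk.hasDerivAt_duhamel_age hf hf' hff' ht.le htT.le hs hy)).div (hS y hy) (hS0 y hy)
    -- Between the time and age derivatives the terms with `f'` and with `f (T - t + y)` cancel. The
    -- integral of `L` cancels against the spatial operator up to `r`, and the source `f y * mix`
    -- and the quotient-rule term in `f y` cancel the jump term.
    · rw [hJL t s y h]
      change _ + M.f i y / S y * _ = _
      have := hS0 y hy
      field_simp
      ring
  · have cτ : ContinuousOn (fun q : ℝ × ℝ × ℝ => c (T - q.1) q.2.1) (openDomain T) :=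
      ((continuous_blackScholesCall (T := T) hK r σ).comp
        (by fun_prop : Continuous fun q : ℝ × ℝ × ℝ => (q.1, q.2.1))).continuousOn
    have cm : ContinuousOn (fun q : ℝ × ℝ × ℝ => M.mix G i q.1 q.2.1) (openDomain T) :=
      ((continuous_mix hlin i).comp
        (by fun_prop : Continuous fun q : ℝ × ℝ × ℝ => (q.1, q.2.1))).continuousOn
    have cC : ∀ {b : ℝ → ℝ → ℝ → ℝ}, ContinuousOn (fun q : ℝ × ℝ × ℝ => b q.1 q.2.1 q.2.2)
        {q | 0 < q.2.1 ∧ 0 < q.2.2} →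
        ContinuousOn (fun q : ℝ × ℝ × ℝ => b 0 (T - q.1) q.2.1) (openDomain T) := fun hb =>
      hb.comp (by fun_prop : Continuous fun q : ℝ × ℝ × ℝ =>
        ((0 : ℝ), T - q.1, q.2.1)).continuousOn fun q hq => ⟨sub_pos.2 hq.2.1, hq.2.2.1⟩
    have cy : ∀ {g : ℝ → ℝ}, ContinuousOn g (Ioi 0) →
        ContinuousOn (fun q : ℝ × ℝ × ℝ => g q.2.2) (openDomain T) := fun hg =>
      hg.comp (by fun_prop) fun q hq => hq.2.2.2.1
    have cty : ∀ {g : ℝ → ℝ}, ContinuousOn g (Ioi 0) →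
        ContinuousOn (fun q : ℝ × ℝ × ℝ => g (T - q.1 + q.2.2)) (openDomain T) := fun hg =>
      hg.comp (by fun_prop) fun q hq => add_pos (sub_pos.2 hq.2.1) hq.2.2.2.1
    have cS : ContinuousOn S (Ioi 0) := fun y hy => (hS y hy).continuousAt.continuousWithinAt
    have hne : ∀ q ∈ openDomain T, S q.2.2 ≠ 0 := fun q hq => hS0 _ hq.2.2.2.1
    have kf := cy hf
    have kS := cy cS
    have kft := cty hf
    have kSt := cty cS
    have k1 := cC hC₁c
    have k2 := cC hC₂c
    have j0 := hEk.continuousOn_duhamel hf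
    have j0' := hEk.continuousOn_duhamel hf'
    have j1 := hD₁k.continuousOn_duhamel hf
    have j2 := hD₂k.continuousOn_duhamel hf
    have jL := hLk.continuousOn_duhamel hf
    refine ⟨ContinuousOn.div ?_ kS hne, ContinuousOn.div ?_ kS hne, ContinuousOn.div ?_ kS hne,
      ContinuousOn.div ?_ (kS.pow 2) fun q hq => pow_ne_zero 2 (hne q hq)⟩
    · exact ((kft.mul cτ).sub (kSt.mul (((ContinuousOn.mul (by fun_prop) k1).add
        (ContinuousOn.mul (by fun_prop) k2)).sub (continuousOn_const.mul cτ)))).sub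
        ((kf.mul cm).add (j0'.add jL))
    · exact (kSt.mul k1).add j1
    · exact (kSt.mul k2).add j2
    · exact (((kft.neg.mul cτ).add j0').mul kS).sub (((kSt.mul cτ).add j0).mul kf.neg)

/-- The fixed-point equation identifies the source `mix G` with the average of the solution at age
zero, which makes the equation non-local in `φ`. Row sums one and zero diagonal entries give the
form with the sum over `j ≠ i`. -/
theorem isClassicalSolution_volterra (M : SemiMarkovMarket k) {T K : ℝ} (hK : 0 < K)
    {G : Fin k → ℝ → ℝ → ℝ} (hG : ∀ j, IsLipschitzPayoff (G j))
    (hfix : ∀ i t s, 0 ≤ t → t ≤ T → 0 ≤ s → G i t s = M.volterra T K G t s i 0) :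
    IsClassicalSolution M T K (M.volterra T K G) := by
  choose φt φs φss φy h htc hsc hssc hyc using M.exists_deriv_volterra (T := T) hK hG
  have hcont : IsContinuousOnClosedDomain T (M.volterra T K G) := fun i =>
    continuousOn_volterra hK (hasLinearPayoffs_of_isLipschitzPayoff hG) i
  have hss : ∀ i t s y, (t, s, y) ∈ openDomain T →
      HasDerivAt (deriv fun s' => M.volterra T K G t s' i y) (φss i t s y) s := by
    intro i t s y hq
    refine (h i t s y hq).2.2.1.congr_of_eventuallyEq ?_
    filter_upwards [Ioi_mem_nhds hq.2.2.1] with s' hs'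
    exact (h i t s' y ⟨hq.1, hq.2.1, hs', hq.2.2.2.1, hq.2.2.2.2⟩).2.1.deriv
  refine ⟨.of_hasDerivAt (fun i => (hcont i).mono (openDomain_subset_closedDomain T))
    (fun i t s y hq => (h i t s y hq).1) (fun i t s y hq => (h i t s y hq).2.1) hss
    (fun i t s y hq => (h i t s y hq).2.2.2.1) htc hsc hssc hyc, hcont, ?_, ?_, ?_⟩
  · intro t s i y hq
    obtain ⟨h1, h2, -, h4, h5⟩ := h i t s y hq
    rw [h1.deriv, h2.deriv, h4.deriv, (hss i t s y hq).deriv, ← h5]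
    congr 2
    have hsum : ∀ c, ∑ j ∈ Finset.univ.erase i, M.p i j * (M.volterra T K G t s j 0 - c) =
        ∑ j, M.p i j * (M.volterra T K G t s j 0 - c) := fun c =>
      Finset.sum_erase _ (by rw [M.p_diag, zero_mul])
    rw [hsum]
    simp only [mul_sub, Finset.sum_sub_distrib, ← Finset.sum_mul, M.p_sum, one_mul, mix]
    congr 1
    exact Finset.sum_congr rfl fun j _ => by rw [hfix j t s hq.1.le hq.2.1.le hq.2.2.1.le]
  · intro t i y _
    exact volterra_stock_zero hK (fun j u => (hG j).zero u) t y i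
  · intro s i y hs hy _
    have hS := (M.one_sub_F_pos i hy).ne'
    rw [volterra, blackScholesCall_eq, sub_self, discountedMean_zero_left,
      intervalIntegral.integral_same, zero_add, add_zero, mul_div_cancel_left₀ _ hS]

/-! ### Linear growth, and translation to the lognormal form of the equation. -/

/-- Ages never exceed `T` on the domain, so the denominator `1 - F y` is at least `1 - F T`, a
positive number. -/
lemma hasLinearGrowth_volterra (M : SemiMarkovMarket k) {T K : ℝ} (hK : 0 < K)
    {G : Fin k → ℝ → ℝ → ℝ} (hG : ∀ j, IsLipschitzPayoff (G j)) :
    HasLinearGrowth T (M.volterra T K G) := by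
  choose D hD using M.f_bounded
  have hle : ∀ {g : ℝ → ℝ → ℝ}, IsLipschitzPayoff g → ∀ (i : Fin k) u {v s}, 0 ≤ v → 0 ≤ s →
      |discountedMean (M.r i) (M.σ i) (g u) v s| ≤ s := fun hg i u v s hv hs => by
    simpa using abs_discountedMean_le (r := M.r i) (σ := M.σ i) (A := 0) (B := 1) hs
      (fun x hx => by simpa [abs_of_nonneg hx] using hg.abs_le u x) hv
  -- The constant is chosen before a point of the domain shows `0 ≤ T`, hence the absolute values.
  refine ⟨∑ i, (1 + |D i| * |T|) / (1 - M.F i |T|), fun t s i y h => ?_⟩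
  obtain ⟨ht, htT, hs, hy, hyt⟩ := h
  have hT : 0 ≤ T := ht.trans htT
  have hτ : 0 ≤ T - t := sub_nonneg.2 htT
  have hST : ∀ i, 0 < 1 - M.F i |T| := fun i => M.one_sub_F_pos i (abs_nonneg T)
  have h1 : |(1 - M.F i (T - t + y)) * blackScholesCall T K (M.r i) (M.σ i) t s| ≤ s := by
    have h2 := M.one_sub_F_pos i (add_nonneg hτ hy)
    have h3 : 0 ≤ M.F i (T - t + y) := cdf_nonneg _ _
    rw [abs_mul, abs_of_pos h2]
    exact (mul_le_of_le_one_left (abs_nonneg _) (by linarith)).trans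
      (hle (isLipschitzPayoff_call hK) i 0 hτ hs)
  have h4 : |∫ v in (0 : ℝ)..(T - t), M.f i (y + v) *
      discountedMean (M.r i) (M.σ i) (M.mix G i (t + v)) v s| ≤ |D i| * |T| * s := by
    rw [← Real.norm_eq_abs]
    refine (intervalIntegral.norm_integral_le_of_norm_le_const (C := |D i| * s)
      fun v hv => ?_).trans ?_
    · rw [uIoc_of_le hτ] at hv
      rw [norm_mul]
      exact mul_le_mul ((hD i _ (by linarith [hv.1])).trans (le_abs_self _))
        (hle (isLipschitzPayoff_mix hG i) i _ hv.1.le hs) (norm_nonneg _) (abs_nonneg _)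
    · rw [sub_zero, abs_of_nonneg hτ, mul_right_comm]
      gcongr
      exact (by linarith : T - t ≤ T).trans (le_abs_self T)
  have h5 : 1 - M.F i |T| ≤ 1 - M.F i y :=
    sub_le_sub_left (monotone_cdf _ ((hyt.trans htT).trans (le_abs_self T))) _
  have h6 : (1 + |D i| * |T|) / (1 - M.F i |T|) ≤
      ∑ i, (1 + |D i| * |T|) / (1 - M.F i |T|) :=
    Finset.single_le_sum (f := fun i => (1 + |D i| * |T|) / (1 - M.F i |T|))
      (fun i _ => div_nonneg (by positivity) (hST i).le) (Finset.mem_univ i)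
  rw [volterra, abs_div, abs_of_pos (M.one_sub_F_pos i hy)]
  calc _ ≤ (s + |D i| * |T| * s) / (1 - M.F i |T|) := by
        have := hST i
        gcongr
        exact (abs_add_le _ _).trans (add_le_add h1 h4)
    _ = (1 + |D i| * |T|) / (1 - M.F i |T|) * s := by ring
    _ ≤ (∑ i, (1 + |D i| * |T|) / (1 - M.F i |T|)) * (1 + s) := by
        gcongr
        · exact (div_nonneg (by positivity) (hST i).le).trans h6
        · linarith

/-- Only delays `0 < v ≤ T - t` and prices `x > 0` enter, so agreement of `φ` with `G` on the strip
suffices, and the lognormal density is never evaluated at its degenerate time. -/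
lemma volterra_eq (M : SemiMarkovMarket k) {T K C : ℝ} {G : Fin k → ℝ → ℝ → ℝ}
    (hG : HasLinearPayoffs G C) {φ : ℝ → ℝ → Fin k → ℝ → ℝ}
    (hφ : ∀ j u x, 0 ≤ u → u ≤ T → 0 ≤ x → φ u x j 0 = G j u x) {t s : ℝ} (ht : 0 ≤ t)
    (htT : t ≤ T) (hs : 0 < s) (i : Fin k) (y : ℝ) :
    (1 - M.F i (T - t + y)) / (1 - M.F i y) * blackScholesCall T K (M.r i) (M.σ i) t s +
      ∫ v in (0 : ℝ)..(T - t),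
        Real.exp (-M.r i * v) * (M.f i (y + v) / (1 - M.F i y)) *
          ∑ j, M.p i j *
            ∫ x in Ioi (0 : ℝ), φ (t + v) x j 0 * lognormalKernel (M.r i) (M.σ i) s v x =
      M.volterra T K G t s i y := by
  rw [volterra, add_div, div_mul_eq_mul_div, ← intervalIntegral.integral_div]
  congr 1
  refine intervalIntegral.integral_congr_ae (Filter.Eventually.of_forall fun v hv => ?_)
  rw [uIoc_of_le (sub_nonneg.2 htT)] at hv
  have h1 : ∀ j, ∫ x in Ioi (0 : ℝ), φ (t + v) x j 0 * lognormalKernel (M.r i) (M.σ i) s v x =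
      gbmMean (M.r i) (M.σ i) (G j (t + v)) v s := fun j => by
    rw [← integral_mul_lognormalKernel (M.r i) (M.σ_pos i) _ hv.1 hs]
    refine setIntegral_congr_fun measurableSet_Ioi fun x hx => ?_
    rw [hφ j (t + v) x (by linarith [hv.1]) (by linarith [hv.2]) (le_of_lt hx)]
  have h2 : gbmMean (M.r i) (M.σ i) (M.mix G i (t + v)) v s =
      ∑ j, M.p i j * gbmMean (M.r i) (M.σ i) (G j (t + v)) v s :=
    gbmMean_sum Finset.univ (fun j => (hG.continuous j).comp
      (by fun_prop : Continuous fun x : ℝ => (t + v, x))) (fun j => hG.bound j (t + v)) _ _ _ _ _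
  simp only [h1]
  rw [discountedMean, h2]
  ring

end SemiMarkovMarket

/-- Among the functions that are continuous on the closed domain and of at most linear growth in
`s`, the integral equation has exactly one solution (as a function on the closed domain), and this
solution is a classical solution of the initial-boundary value problem. -/
theorem proposition3p1 (k : ℕ) (M : SemiMarkovMarket k) (T K : ℝ) (hT : 0 < T) (hK : 0 < K) :
    ∃ φ : ℝ → ℝ → Fin k → ℝ → ℝ,
      (IsContinuousOnClosedDomain T φ ∧ HasLinearGrowth T φ ∧ SolvesIntegralEquation M T K φ) ∧
      (∀ ψ : ℝ → ℝ → Fin k → ℝ → ℝ,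
        IsContinuousOnClosedDomain T ψ → HasLinearGrowth T ψ → SolvesIntegralEquation M T K ψ →
        ∀ t s i y, (t, s, y) ∈ closedDomain T → ψ t s i y = φ t s i y) ∧
      IsClassicalSolution M T K φ := by
  obtain ⟨G, hG, hfix⟩ := M.exists_volterra_fixedPoint hT.le hK
  have hlin := SemiMarkovMarket.hasLinearPayoffs_of_isLipschitzPayoff hG
  have hfix' : ∀ i t s, 0 ≤ t → t ≤ T → 0 ≤ s → G i t s = M.volterra T K G t s i 0 :=
    fun i t s ht htT hs => by rw [hfix, clampTime_of_mem ht htT, max_eq_left hs]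
  have hclass := M.isClassicalSolution_volterra hK hG hfix'
  have hjump : ∀ {t y : ℝ} {s : ℝ}, (t, s, y) ∈ closedDomain T → (t, s, (0 : ℝ)) ∈ closedDomain T :=
    fun h => ⟨h.1, h.2.1, h.2.2.1, le_rfl, h.1⟩
  refine ⟨M.volterra T K G, ⟨hclass.continuous, ?_, ?_, hclass.boundary⟩, ?_, hclass⟩
  · exact M.hasLinearGrowth_volterra hK hG
  · intro t s i y h hs
    exact (M.volterra_eq hlin (fun j u x hu huT hx => (hfix' j u x hu huT hx).symm) h.1 h.2.1 hs i
      y).symm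
  · intro ψ hψc ⟨C, hC⟩ hψ t s i y h
    -- The competitor is controlled only on the closed domain; clamping its trace at age zero gives
    -- a globally continuous family to which the uniqueness theorem applies.
    set G' : Fin k → ℝ → ℝ → ℝ := fun j u x => ψ (clampTime T u) (max x 0) j 0 with hG'def
    have hC0 : 0 ≤ C := by
      have := (abs_nonneg _).trans (hC 0 0 i 0 ⟨le_rfl, hT.le, le_rfl, le_rfl, le_rfl⟩)
      simpa using this
    have hG' : HasLinearPayoffs G' C := by
      refine ⟨fun j => ?_, fun j u x => ?_⟩
      · exact (hψc j).comp_continuous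
          (f := fun q : ℝ × ℝ => (clampTime T q.1, max q.2 0, (0 : ℝ)))
          (by have := continuous_clampTime T; fun_prop) fun q => closedDomain_clamp hT.le q.1 q.2
      · refine (hC _ _ _ _ (closedDomain_clamp hT.le u x)).trans ?_
        have : max x 0 ≤ |x| := max_le (le_abs_self x) (abs_nonneg x)
        gcongr
    have hψG' : ∀ j u x, 0 ≤ u → u ≤ T → 0 ≤ x → ψ u x j 0 = G' j u x :=
      fun j u x hu huT hx => by simp only [hG'def]; rw [clampTime_of_mem hu huT, max_eq_left hx]
    have hzero : ∀ j u, G' j u 0 = 0 := fun j u => by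
      simp only [hG'def, max_self]
      exact hψ.zero_at_zero _ _ _ (by simpa using closedDomain_clamp hT.le u 0)
    have hψeq : ∀ t s i y, (t, s, y) ∈ closedDomain T → ψ t s i y = M.volterra T K G' t s i y := by
      intro t s i y h
      rcases eq_or_lt_of_le (show 0 ≤ s from h.2.2.1) with rfl | hs
      · rw [hψ.zero_at_zero t i y h, SemiMarkovMarket.volterra_stock_zero hK hzero]
      · rw [hψ.equation t s i y h hs, M.volterra_eq hG' hψG' h.1 h.2.1 hs i y]
    have huniq : ∀ j u x, 0 ≤ u → u ≤ T → 0 ≤ x → G' j u x = G j u x := fun j u x hu huT hx =>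
      M.volterra_fixedPoint_unique hG' hlin (fun j t s ht htT hs => by
        rw [← hψG' j t s ht htT hs]
        exact hψeq t s j 0 ⟨ht, htT, hs, le_rfl, ht⟩) hfix' j hu huT hx
    -- Equal traces at age zero give equal right-hand sides, hence equality at every age.
    rcases eq_or_lt_of_le (show 0 ≤ s from h.2.2.1) with rfl | hs
    · rw [hψ.zero_at_zero t i y h, hclass.boundary t i y h]
    · rw [hψ.equation t s i y h hs]
      exact M.volterra_eq hlin (fun j u x hu huT hx => by
        rw [hψG' j u x hu huT hx, huniq j u x hu huT hx]) h.1 h.2.1 hs i y
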